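/- Let $q,r\ge 2$ be integers and $\alpha\in(0,1)$. For $k \geq 2$ let $\mathbb T_k$ be the homogeneous tree of degree $k+1$ with a fixed root $o$ and a fixed reference end $\omega$, and let $\mathfrak h:\mathbb T_k\to\mathbb Z$ be the Busemann function with respect to $\omega$, normalized by $\mathfrak h(o)=0$; every vertex $x$ has exactly one neighbour $x^-$ (its predecessor) with $\mathfrak h(x^-)=\mathfrak h(x)-1$, and $k$ neighbours $y$ (its successors) with $\mathfrak h(y)=\mathfrak h(x)+1$. The Diestel--Leader graph is $$\mathrm{DL}=\mathrm{DL}(q,r)=\{x_1x_2\in\mathbb T_q\times\mathbb T_r:\mathfrak h(x_1)+\mathfrak h(x_2)=0\},\qquad x_1x_2\sim y_1y_2\iff x_1\sim y_1\text{ and }x_2\sim y_2 .$$ Let $P$ be the transition operator of simple random walk on $\mathrm{DL}$, acting on $\ell^2(\mathrm{DL})$, and let $P_\alpha f(x)=\sum_y p_\alpha(x,y)f(y)$, acting on the weighted space $\ell^2(\mathrm{DL},m_\alpha)$, where $$p_\alpha(x,y)=\begin{cases}\alpha/q & \text{if } y_1^-=x_1\text{ and }y_2=x_2^-,\\ (1-\alpha)/r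 & \text{if } y_1=x_1^-\text{ and }y_2^-=x_2,\\ 0&\text{otherwise,}\end{cases}\qquad m_\alpha(x)=\Bigl(\frac{\alpha r}{(1-\alpha)q}\Bigr)^{\mathfrak h(x_1)} .$$ Put $\rho=\frac{2\sqrt{qr}}{q+r}$ and $t_\alpha=\sqrt{4\alpha(1-\alpha)}/\rho$. For a transition operator on a weighted space $\ell^2(\mathrm{DL},m)$ (with $m\equiv1$ for $P$ and $m=m_\alpha$ for $P_\alpha$) with resolution of the identity $E$, its Plancherel measure is the Borel measure $\mu(A)=\langle\delta_x,E(A)\delta_x\rangle_m/m(x)$, where $\langle f,g\rangle_m=\sum_y\overline{f(y)}\,g(y)\,m(y)$, provided that this does not depend on $x\in\mathrm{DL}$. Then $P$ and $P_\alpha$ are well-defined bounded operators on these spaces, and: 1. $\operatorname{spec}(P)=[-\rho,\rho]$ and $\operatorname{spec}(P_\alpha)=\bigl[-\sqrt{4\alpha(1-\alpha)},\sqrt{4\alpha(1-\alpha)}\bigr]$; 2. $\operatorname{spec}(P_\alpha)=t_\alpha\cdot\operatorname{spec}(P)$; 3. $P$ and $P_\alpha$ have well-defined Plancherel measures, and that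 of $P_\alpha$ is the image of that of $P$ under the dilation $s\mapsto t_\alpha s$. -/

import Mathlib

open MeasureTheory
open scoped ENNReal InnerProductSpace

noncomputable section

namespace DiestelLeader

/-- The vertices of the homogeneous tree `𝕋_q` with a chosen end `ω`, in the coding
`Σ_q × ℤ`: the vertex `x` is given by the index `hor x` of its horocycle (the value of the
Busemann function at `x`) and by the finitely supported sequence of labels in `ℤ_q` of the
successive edges of the geodesic ray from `x` to `ω`
(`labels i` is the label of the `i`-th edge of that ray). -/
@[ext]
structure Tree (q : ℕ) where
  labels : ℕ →₀ ZMod q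
  hor : ℤ

namespace Tree

variable {q : ℕ}

/-- The predecessor `x⁻` of `x`: the neighbour of `x` in the direction of `ω`. -/
def pred (x : Tree q) : Tree q where
  labels := x.labels.comapDomain (fun i => i + 1) (add_left_injective 1).injOn
  hor := x.hor - 1

/-- The tree `𝕋_q` as a graph: every vertex is joined to its predecessor. -/
def graph (q : ℕ) : SimpleGraph (Tree q) where
  Adj x y := x.pred = y ∨ y.pred = x
  symm := ⟨fun _ _ h => h.symm⟩
  loopless := ⟨fun x h => by
    have h1 : x.pred = x := by tauto
    have h2 := congrArg Tree.hor h1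
    simp [pred] at h2⟩

/-! The coding gives a tree in which every vertex has `q + 1` neighbours. -/

theorem iterate_pred_hor (x : Tree q) (n : ℕ) : (pred^[n] x).hor = x.hor - n := by
  induction n with
  | zero => simp
  | succ n ih => rw [Function.iterate_succ_apply']; simp only [pred, ih]; push_cast; ring

theorem iterate_pred_labels (x : Tree q) (n i : ℕ) :
    (pred^[n] x).labels i = x.labels (i + n) := by
  induction n generalizing i with
  | zero => simp
  | succ n ih =>
    rw [Function.iterate_succ_apply']
    simp only [pred, Finsupp.comapDomain_apply, ih]
    congr 1; ring

theorem reachable_iterate (x : Tree q) (n : ℕ) : (graph q).Reachable x (pred^[n] x) := by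
  induction n with
  | zero => exact SimpleGraph.Reachable.refl _
  | succ n ih =>
    rw [Function.iterate_succ_apply']
    exact ih.trans (SimpleGraph.Adj.reachable (Or.inl rfl))

theorem exists_iterate_eq (x y : Tree q) : ∃ m n : ℕ, pred^[m] x = pred^[n] y := by
  obtain ⟨a, ha⟩ := x.labels.support.exists_nat_subset_range
  obtain ⟨b, hb⟩ := y.labels.support.exists_nat_subset_range
  refine ⟨a + b + (x.hor - y.hor).toNat, a + b + (y.hor - x.hor).toNat, ?_⟩
  ext i
  · rw [iterate_pred_labels, iterate_pred_labels]
    have h1 : x.labels (i + (a + b + (x.hor - y.hor).toNat)) = 0 := by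
      by_contra h
      have := Finset.mem_range.1 (ha (Finsupp.mem_support_iff.2 h))
      omega
    have h2 : y.labels (i + (a + b + (y.hor - x.hor).toNat)) = 0 := by
      by_contra h
      have := Finset.mem_range.1 (hb (Finsupp.mem_support_iff.2 h))
      omega
    rw [h1, h2]
  · rw [iterate_pred_hor, iterate_pred_hor]
    omega

/-- The graph on `Σ_q × ℤ` is a tree. -/
theorem graph_isTree (q : ℕ) : (graph q).IsTree := by
  have : Nonempty (Tree q) := ⟨⟨0, 0⟩⟩
  refine ⟨⟨fun x y => ?_⟩, ?_⟩
  · obtain ⟨m, n, h⟩ := exists_iterate_eq x y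
    exact (h ▸ reachable_iterate x m).trans (reachable_iterate y n).symm
  · rw [SimpleGraph.isAcyclic_iff_forall_adj_isBridge]
    have key : ∀ x : Tree q, (graph q).IsBridge s(x, x.pred) := by
      intro x
      rw [SimpleGraph.isBridge_iff]
      have inv : ∀ y z : Tree q, ((graph q).deleteEdges {s(x, x.pred)}).Reachable y z →
          (∃ n, pred^[n] y = x) → ∃ n, pred^[n] z = x := by
        rintro y z ⟨w⟩
        induction w with
        | nil => exact id
        | cons h _ ih =>
          rintro ⟨n, hn⟩
          apply ih
          rw [SimpleGraph.deleteEdges_adj] at h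
          obtain ⟨h1 | h1, h2⟩ := h
          · cases n with
            | zero => subst h1; subst hn; simp at h2
            | succ n => exact ⟨n, by rw [← h1, ← hn]; rfl⟩
          · exact ⟨n + 1, by rw [Function.iterate_succ_apply, h1, hn]⟩
      intro h
      obtain ⟨n, hn⟩ := inv _ _ h ⟨0, rfl⟩
      have h3 := congrArg hor hn
      rw [iterate_pred_hor] at h3
      simp only [pred] at h3
      omega
    rintro x y (h | h)
    · exact h ▸ key x
    · rw [Sym2.eq_swap]; exact h ▸ key y

/-- Every vertex has `q + 1` neighbours. -/
theorem ncard_neighborSet [NeZero q] (x : Tree q) : ((graph q).neighborSet x).ncard = q + 1 := by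
  classical
  let succ : ZMod q → Tree q := fun s =>
    ⟨(x.labels.mapDomain (fun i => i + 1)) + Finsupp.single 0 s, x.hor + 1⟩
  have hs0 : ∀ s, (succ s).labels 0 = s := by
    intro s
    simp only [succ, Finsupp.add_apply, Finsupp.single_eq_same]
    rw [Finsupp.mapDomain_of_notMem_range _ _ (by simp), zero_add]
  have hs1 : ∀ s i, (succ s).labels (i + 1) = x.labels i := by
    intro s i
    simp only [succ, Finsupp.add_apply]
    rw [Finsupp.mapDomain_apply (add_left_injective 1)]
    simp
  have h : (graph q).neighborSet x = insert x.pred (Set.range succ) := by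
    ext y
    simp only [SimpleGraph.mem_neighborSet, graph, Set.mem_insert_iff, Set.mem_range]
    refine or_congr eq_comm ⟨fun h => ⟨y.labels 0, ?_⟩, ?_⟩
    · ext i
      · cases i with
        | zero => rw [hs0]
        | succ i => rw [hs1, ← h]; simp [pred]
      · have h' : y.hor - 1 = x.hor := congrArg hor h
        simp only [succ]
        omega
    · rintro ⟨s, rfl⟩
      ext i
      · rw [← hs1 s i]; simp [pred]
      · simp [succ, pred]
  have hinj : Function.Injective succ := fun s t h => by rw [← hs0 s, ← hs0 t, h]
  rw [h, Set.ncard_insert_of_notMem, ← Set.image_univ, Set.ncard_image_of_injective _ hinj,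
    Set.ncard_univ, Nat.card_zmod]
  rintro ⟨s, hs⟩
  have := congrArg hor hs
  simp only [succ, pred] at this
  omega

end Tree

/-- The vertex set of the Diestel-Leader graph `DL(q,r)`: pairs `x₁x₂` of vertices of `𝕋_q`
and `𝕋_r` with `hor x₁ + hor x₂ = 0`. -/
def DL (q r : ℕ) : Type := {x : Tree q × Tree r // x.1.hor + x.2.hor = 0}

namespace DL

variable {q r : ℕ}

/-- The first component `x₁` of `x = x₁x₂`. -/
def fst (x : DL q r) : Tree q := x.1.1

/-- The second component `x₂` of `x = x₁x₂`. -/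
def snd (x : DL q r) : Tree r := x.1.2

/-- The Diestel-Leader graph: `x₁x₂ ∼ y₁y₂` iff `x₁ ∼ y₁` and `x₂ ∼ y₂`. -/
def graph (q r : ℕ) : SimpleGraph (DL q r) where
  Adj x y := (Tree.graph q).Adj x.fst y.fst ∧ (Tree.graph r).Adj x.snd y.snd
  symm := ⟨fun _ _ h => ⟨h.1.symm, h.2.symm⟩⟩
  loopless := ⟨fun x h => (Tree.graph q).loopless.irrefl x.fst h.1⟩

end DL

open Classical in
/-- The transition probabilities of simple random walk on a graph. -/
def srwKernel {X : Type*} (G : SimpleGraph X) (x y : X) : ℝ :=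
  if G.Adj x y then 1 / ((G.neighborSet x).ncard : ℝ) else 0

open Classical in
/-- The transition probabilities `p_α(x,y)` of the walk with drift on `DL(q,r)`. -/
def driftKernel (q r : ℕ) (α : ℝ) (x y : DL q r) : ℝ :=
  if y.fst.pred = x.fst ∧ y.snd = x.snd.pred then α / q
  else if y.fst = x.fst.pred ∧ y.snd.pred = x.snd then (1 - α) / r
  else 0

/-- The reversing measure `m_α(x) = (α r / ((1 - α) q)) ^ hor x₁`. -/
def driftWeight (q r : ℕ) (α : ℝ) (x : DL q r) : ℝ :=
  (α * r / ((1 - α) * q)) ^ x.fst.hor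

/-- The number `ρ = 2 √(qr) / (q + r)`. -/
def rho (q r : ℕ) : ℝ := 2 * √((q : ℝ) * r) / (q + r)

/-- The dilation factor `t_α = √(4α(1 - α)) / ρ`. -/
def dilationFactor (q r : ℕ) (α : ℝ) : ℝ := √(4 * α * (1 - α)) / rho q r

/-! ### Weighted `ℓ²`-spaces and transition operators -/

/-- Every subset of `DL(q,r)` is measurable. -/
instance (q r : ℕ) : MeasurableSpace (DL q r) := ⊤

instance (q r : ℕ) : DiscreteMeasurableSpace (DL q r) := ⟨fun _ => trivial⟩

section Weighted

variable {X : Type*} [MeasurableSpace X] [DiscreteMeasurableSpace X]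

/-- The measure `∑ₓ m(x) δₓ` on `X`. -/
def weightMeasure (m : X → ℝ) : Measure X :=
  Measure.sum fun x => ENNReal.ofReal (m x) • Measure.dirac x

/-- The complex Hilbert space `ℓ²(X,m)`, with inner product `∑ₓ conj (f x) * g x * m x`. -/
abbrev EllTwo (m : X → ℝ) : Type _ := Lp ℂ 2 (weightMeasure m)

theorem weightMeasure_singleton (m : X → ℝ) (x : X) :
    weightMeasure m {x} = ENNReal.ofReal (m x) := by
  classical
  rw [weightMeasure, Measure.sum_apply _ (MeasurableSet.of_discrete)]
  rw [tsum_eq_single x]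
  · simp
  · intro y hy
    simp [Measure.dirac_apply' _ (MeasurableSet.of_discrete (s := {x})), hy]

/-- The normalized point mass `m(x)^(-1/2) δₓ`, a unit vector of `ℓ²(X,m)` when `m x > 0`. -/
def unitVec (m : X → ℝ) (x : X) : EllTwo m :=
  indicatorConstLp 2 (MeasurableSet.of_discrete (s := {x}))
    (by rw [weightMeasure_singleton]; exact ENNReal.ofReal_ne_top)
    (((√(m x))⁻¹ : ℝ) : ℂ)

/-- The bounded operator `T` on `ℓ²(X,m)` is the operator `f ↦ ∑_y p(·,y) f(y)`. When `m` is
positive everywhere, the elements of `ℓ²(X,m)` are functions on `X`, so that the kernel `p`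
determines `T`. -/
def IsTransitionOperator (m : X → ℝ) (p : X → X → ℝ) (T : EllTwo m →L[ℂ] EllTwo m) : Prop :=
  ∀ (f : EllTwo m) (x : X),
    Summable (fun y => (p x y : ℂ) * f y) ∧ T f x = ∑' y, (p x y : ℂ) * f y

end Weighted

/-! ### Resolutions of the identity -/

section Spectral

variable {H : Type*} [NormedAddCommGroup H] [InnerProductSpace ℂ H] [CompleteSpace H]

/-- A projection-valued Borel measure on `ℝ`. Only the values on Borel sets matter. -/
structure ProjectionValuedMeasure (H : Type*) [NormedAddCommGroup H] [InnerProductSpace ℂ H]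
    [CompleteSpace H] where
  proj : Set ℝ → H →L[ℂ] H
  isSelfAdjoint : ∀ A, MeasurableSet A → IsSelfAdjoint (proj A)
  inter : ∀ A B, MeasurableSet A → MeasurableSet B → proj (A ∩ B) = proj A * proj B
  empty : proj ∅ = 0
  univ : proj Set.univ = 1
  iUnion : ∀ A : ℕ → Set ℝ, (∀ n, MeasurableSet (A n)) →
    Pairwise (Function.onFun Disjoint A) →
    ∀ v, HasSum (fun n => proj (A n) v) (proj (⋃ n, A n) v)

namespace ProjectionValuedMeasure

theorem inner_proj (E : ProjectionValuedMeasure H) (v : H) {A : Set ℝ} (hA : MeasurableSet A) :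
    (⟪v, E.proj A v⟫_ℂ).re = ‖E.proj A v‖ ^ 2 := by
  have h1 : E.proj A = E.proj A * E.proj A := by
    rw [← E.inter A A hA hA, Set.inter_self]
  have h2 : ⟪v, E.proj A v⟫_ℂ = ⟪E.proj A v, E.proj A v⟫_ℂ := by
    conv_lhs => rw [h1]
    rw [mul_apply_eq_comp, ← ContinuousLinearMap.adjoint_inner_left,
      ← ContinuousLinearMap.star_eq_adjoint, (E.isSelfAdjoint A hA).star_eq]
  rw [h2, inner_self_eq_norm_sq_to_K]
  norm_cast

/-- The Borel measure `A ↦ ⟨v, E(A) v⟩` on `ℝ`. -/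
def scalarMeasure (E : ProjectionValuedMeasure H) (v : H) : Measure ℝ :=
  Measure.ofMeasurable (fun A _ => ENNReal.ofReal (⟪v, E.proj A v⟫_ℂ).re)
    (by simp [E.empty])
    (by
      intro A hA hd
      have hs : HasSum (fun n => (⟪v, E.proj (A n) v⟫_ℂ).re)
          (⟪v, E.proj (⋃ n, A n) v⟫_ℂ).re := by
        have h1 := (E.iUnion A hA hd v).mapL (innerSL ℂ v)
        have h2 := h1.mapL Complex.reCLM
        simpa using h2
      rw [← hs.tsum_eq]
      exact ENNReal.ofReal_tsum_of_nonneg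
        (fun n => by rw [E.inner_proj v (hA n)]; positivity) hs.summable)

theorem scalarMeasure_apply (E : ProjectionValuedMeasure H) (v : H) {A : Set ℝ}
    (hA : MeasurableSet A) :
    E.scalarMeasure v A = ENNReal.ofReal (⟪v, E.proj A v⟫_ℂ).re :=
  Measure.ofMeasurable_apply A hA

/-- `E` is the resolution of the identity of `T`: it lives on the spectrum of `T`, and
`T ^ N = ∫ s ^ N E(ds)` for all `N ≥ 0`. (By polarization it is enough to state this identity
for the quadratic forms `⟨v, · v⟩`.) -/
def IsResolutionOf (E : ProjectionValuedMeasure H) (T : H →L[ℂ] H) : Prop :=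
  E.proj {s : ℝ | (s : ℂ) ∈ spectrum ℂ T} = 1 ∧
  ∀ (N : ℕ) (v : H), ⟪v, (T ^ N) v⟫_ℂ = ((∫ s, s ^ N ∂(E.scalarMeasure v) : ℝ) : ℂ)

end ProjectionValuedMeasure

end Spectral

/-- `μ` is the Plancherel measure of the operator `T` on `ℓ²(X,m)`: the common diagonal spectral
measure `μ(A) = ⟨δₓ, E(A) δₓ⟩ / m(x)`, for all `x`, of the resolution `E` of the identity
of `T`. -/
def IsPlancherelMeasure {X : Type*} [MeasurableSpace X] [DiscreteMeasurableSpace X]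
    (m : X → ℝ) (T : EllTwo m →L[ℂ] EllTwo m) (μ : Measure ℝ) : Prop :=
  ∃ E : ProjectionValuedMeasure (EllTwo m),
    E.IsResolutionOf T ∧ ∀ x, E.scalarMeasure (unitVec m x) = μ

end DiestelLeader

end

/-! Multiplication by `√m` is a unitary map from the weighted space onto the unweighted `ℓ²(DL)`.
Under it both walks become positive multiples of one operator, the adjacency operator `A` (`adjOp`):
the factors are `1/(q+r)` for `P` and `√(α(1-α)/(qr))` for `P_α`, and their quotient is `t_α`.
Everything thus reduces to `A`.

`A` is an edge sum plus its adjoint, and Cauchy–Schwarz bounds each by `√(qr)`, so the spectrum lies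
in `[-2√(qr), 2√(qr)]`. Eigenfunctions come from products of Haar functions on generation `k` below
a vertex `a` and generation `l` below a vertex `b`. With `a`, `b`, the zero-sum coefficients and `n
= k + l` fixed, these products span a finite-dimensional space on which `A` is tridiagonal with
Dirichlet ends (`adjOp_haarVec`). It yields the eigenvalues `2√(qr) cos(jπ/n)`, `0 < j < n`, which
are dense in the interval (`spectrum_adjOp`).

The eigenfunctions are complete (`iSup_eigenspace_adjOp_orthogonal`), so `A` is diagonal in an
orthonormal basis and its resolution of the identity is explicit (`basisPVM`). Automorphisms act
transitively on `DL`, so the moments `⟨δ_x, A^N δ_x⟩` do not depend on `x`. Measures of bounded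
support are determined by their moments (`measure_ext_of_moments`); this gives existence and
uniqueness of the Plancherel measures, and the dilation between them. -/

namespace DiestelLeader

/-! ### Operators with an orthonormal basis of eigenvectors -/

section Diagonal

universe u

variable {H : Type u} [NormedAddCommGroup H] [InnerProductSpace ℂ H] [CompleteSpace H]

/-- Eigenspaces of a self-adjoint operator are closed and mutually orthogonal, so orthonormal bases
of the single eigenspaces together form a basis of `H`. The eigenvalues are real by
self-adjointness. -/
theorem exists_hilbertBasis_eigenvectors {T : H →L[ℂ] H} (hT : IsSelfAdjoint T)
    (hd : (⨆ z, Module.End.eigenspace (T : H →ₗ[ℂ] H) z)ᗮ = ⊥) :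
    ∃ (ι : Type u) (b : HilbertBasis ι ℂ H) (l : ι → ℝ), ∀ i, T (b i) = (l i : ℂ) • b i := by
  have hsym : (T : H →ₗ[ℂ] H).IsSymmetric := ContinuousLinearMap.isSelfAdjoint_iff_isSymmetric.1 hT
  have hcl : ∀ z, IsClosed (Module.End.eigenspace (T : H →ₗ[ℂ] H) z : Set H) := by
    intro z
    have : (Module.End.eigenspace (T : H →ₗ[ℂ] H) z : Set H) = {x | T x = z • x} := by
      ext x; simp
    rw [this]
    exact isClosed_eq T.continuous (continuous_const_smul z)
  have : ∀ z, CompleteSpace (Module.End.eigenspace (T : H →ₗ[ℂ] H) z) :=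
    fun z => (hcl z).completeSpace_coe
  choose w b hb using fun z => exists_hilbertBasis ℂ (Module.End.eigenspace (T : H →ₗ[ℂ] H) z)
  have ho := hsym.orthogonalFamily_eigenspaces.orthonormal_sigma_orthonormal
    (v_family := fun z => (b z : w z → _)) (fun z => (b z).orthonormal)
  let B : HilbertBasis (Σ z, w z) ℂ H := HilbertBasis.mkOfOrthogonalEqBot ho (by
    rw [eq_bot_iff, ← hd]
    intro x hx
    rw [Submodule.mem_orthogonal] at hx ⊢
    -- A vector orthogonal to all chosen basis vectors is orthogonal to each whole eigenspace, by
    -- expanding in the basis of that eigenspace.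
    have hsub : ∀ z, Module.End.eigenspace (T : H →ₗ[ℂ] H) z ≤ (Submodule.span ℂ {x})ᗮ := by
      intro z u hu
      rw [Submodule.mem_orthogonal_singleton_iff_inner_left]
      have hs := ((b z).hasSum_repr ⟨u, hu⟩).mapL
        ((innerSL ℂ x).comp (Module.End.eigenspace (T : H →ₗ[ℂ] H) z).subtypeL)
      have h0 : ∀ i, ⟪x, ((b z i : Module.End.eigenspace (T : H →ₗ[ℂ] H) z) : H)⟫_ℂ = 0 := by
        intro i
        exact inner_eq_zero_symm.1 (hx _ (Submodule.subset_span ⟨⟨z, i⟩, rfl⟩))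
      simp only [map_smul, ContinuousLinearMap.comp_apply, Submodule.subtypeL_apply,
        innerSL_apply_apply, h0, smul_zero] at hs
      exact inner_eq_zero_symm.1 (hs.unique hasSum_zero)
    intro u hu
    exact Submodule.mem_orthogonal_singleton_iff_inner_left.1 ((iSup_le hsub) hu))
  have hB : ∀ i, B i = ((b i.1 i.2 : Module.End.eigenspace (T : H →ₗ[ℂ] H) i.1) : H) := by
    intro i
    simp only [B, HilbertBasis.coe_mkOfOrthogonalEqBot]
    rfl
  have hTB : ∀ i, T (B i) = i.1 • B i := by
    intro i
    have := (b i.1 i.2).2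
    rw [Module.End.mem_eigenspace_iff] at this
    rw [hB]; exact this
  refine ⟨_, B, fun i => i.1.re, fun i => ?_⟩
  have hne : B i ≠ 0 := B.orthonormal.ne_zero i
  have hev : Module.End.HasEigenvalue (T : H →ₗ[ℂ] H) i.1 :=
    Module.End.hasEigenvalue_of_hasEigenvector
      (x := B i) ⟨Module.End.mem_eigenspace_iff.2 (hTB i), hne⟩
  rw [hTB, Complex.conj_eq_iff_re.1 (hsym.conj_eigenvalue_eq_self hev)]

/-- The orthogonal projection onto the closed span of the basis vectors with label in `A`. -/
noncomputable def basisProj {ι : Type*} (b : HilbertBasis ι ℂ H) (l : ι → ℝ) (A : Set ℝ) :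
    H →L[ℂ] H :=
  (Submodule.span ℂ (b '' (l ⁻¹' A))).topologicalClosure.starProjection

theorem basisProj_apply {ι : Type*} (b : HilbertBasis ι ℂ H) (l : ι → ℝ) (A : Set ℝ) (i : ι) :
    basisProj b l A (b i) = (l ⁻¹' A).indicator (fun i => b i) i := by
  by_cases hi : i ∈ l ⁻¹' A
  · rw [Set.indicator_of_mem hi, basisProj, Submodule.starProjection_eq_self_iff]
    exact Submodule.le_topologicalClosure _ (Submodule.subset_span ⟨i, hi, rfl⟩)
  · rw [Set.indicator_of_notMem hi, basisProj, Submodule.starProjection_apply_eq_zero_iff,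
      Submodule.orthogonal_closure, Submodule.mem_orthogonal]
    intro u hu
    have : Submodule.span ℂ (b '' (l ⁻¹' A)) ≤ (Submodule.span ℂ {b i})ᗮ := by
      rw [Submodule.span_le]
      rintro _ ⟨j, hj, rfl⟩
      rw [SetLike.mem_coe, Submodule.mem_orthogonal_singleton_iff_inner_left]
      exact b.orthonormal.2 (by rintro rfl; exact hi hj)
    exact Submodule.mem_orthogonal_singleton_iff_inner_left.1 (this hu)

omit [CompleteSpace H] in
theorem hilbertBasis_clm_ext {ι : Type*} (b : HilbertBasis ι ℂ H) {S T : H →L[ℂ] H}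
    (h : ∀ i, S (b i) = T (b i)) : S = T := by
  refine ContinuousLinearMap.ext_on (s := Set.range b) ?_ ?_
  · rw [← Submodule.dense_iff_topologicalClosure_eq_top.symm.eq]
    exact b.dense_span
  · rintro _ ⟨i, rfl⟩; exact h i

theorem hasSum_basisProj {ι : Type*} (b : HilbertBasis ι ℂ H) (l : ι → ℝ) (A : Set ℝ) (v : H) :
    HasSum ((l ⁻¹' A).indicator fun i => b.repr v i • b i) (basisProj b l A v) := by
  have h := (b.hasSum_repr v).mapL (basisProj b l A)
  convert h using 2 with i
  rw [map_smul, basisProj_apply]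
  by_cases hi : i ∈ l ⁻¹' A <;> simp [hi]

/-- The resolution of the identity of a diagonal operator. -/
noncomputable def basisPVM {ι : Type*} (b : HilbertBasis ι ℂ H) (l : ι → ℝ) :
    ProjectionValuedMeasure H where
  proj := basisProj b l
  isSelfAdjoint A _ := ContinuousLinearMap.isSelfAdjoint_iff_isSymmetric.2
    (Submodule.starProjection_isSymmetric _)
  inter A B _ _ := hilbertBasis_clm_ext b fun i => by
    rw [mul_apply_eq_comp, basisProj_apply, basisProj_apply]
    by_cases hB : i ∈ l ⁻¹' B
    · rw [Set.indicator_of_mem hB, basisProj_apply]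
      by_cases hA : i ∈ l ⁻¹' A
      · rw [Set.indicator_of_mem hA,
          Set.indicator_of_mem (show i ∈ l ⁻¹' (A ∩ B) from ⟨hA, hB⟩)]
      · rw [Set.indicator_of_notMem hA,
          Set.indicator_of_notMem (show i ∉ l ⁻¹' (A ∩ B) from fun h => hA h.1)]
    · rw [Set.indicator_of_notMem hB,
        Set.indicator_of_notMem (show i ∉ l ⁻¹' (A ∩ B) from fun h => hB h.2), map_zero]
  empty := hilbertBasis_clm_ext b fun i => by simp [basisProj_apply]
  univ := hilbertBasis_clm_ext b fun i => by simp [basisProj_apply]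
  iUnion A _ hd v := by
    have hd' : Pairwise (Function.onFun Disjoint fun n => l ⁻¹' A n) :=
      fun m n hmn => (hd hmn).preimage l
    have h := hasSum_basisProj b l (⋃ n, A n) v
    -- Countable additivity: the expansion over the disjoint union of index sets is regrouped into
    -- one block for each `A n`.
    rw [← hasSum_subtype_iff_indicator, Set.preimage_iUnion,
      ← (Set.unionEqSigmaOfDisjoint hd').symm.hasSum_iff] at h
    refine h.sigma fun n => ?_
    have h' := hasSum_basisProj b l (A n) v
    rw [← hasSum_subtype_iff_indicator] at h'
    exact h'

/-- The spectral measures are purely atomic, which turns moments into sums over the basis. -/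
theorem basisPVM_scalarMeasure {ι : Type*} (b : HilbertBasis ι ℂ H) (l : ι → ℝ) (v : H) :
    (basisPVM b l).scalarMeasure v =
      Measure.sum fun i => ENNReal.ofReal (‖b.repr v i‖ ^ 2) • Measure.dirac (l i) := by
  ext A hA
  have h := ((hasSum_basisProj b l A v).mapL (innerSL ℂ v)).mapL Complex.reCLM
  have h' : ∀ i, Complex.reCLM (innerSL ℂ v ((l ⁻¹' A).indicator (fun i => b.repr v i • b i) i))
      = (l ⁻¹' A).indicator (fun i => ‖b.repr v i‖ ^ 2) i := by
    intro i
    by_cases hi : i ∈ l ⁻¹' A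
    · rw [Set.indicator_of_mem hi, Set.indicator_of_mem hi, map_smul, innerSL_apply_apply,
        ← inner_conj_symm, ← b.repr_apply_apply, smul_eq_mul, Complex.mul_conj,
        Complex.normSq_eq_norm_sq]
      exact Complex.ofReal_re _
    · rw [Set.indicator_of_notMem hi, Set.indicator_of_notMem hi]; simp
  simp only [h'] at h
  rw [ProjectionValuedMeasure.scalarMeasure_apply _ _ hA, Measure.sum_apply _ hA]
  change ENNReal.ofReal (⟪v, basisProj b l A v⟫_ℂ).re = _
  have h2 : (⟪v, basisProj b l A v⟫_ℂ).re = _ := h.tsum_eq.symm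
  rw [h2, ENNReal.ofReal_tsum_of_nonneg
    (fun i => Set.indicator_nonneg (fun _ _ => by positivity) i) h.summable]
  refine tsum_congr fun i => ?_
  by_cases hi : l i ∈ A
  · rw [Set.indicator_of_mem (show i ∈ l ⁻¹' A from hi)]
    simp [hA, hi]
  · rw [Set.indicator_of_notMem (show i ∉ l ⁻¹' A from hi)]
    simp [hA, hi]

theorem ProjectionValuedMeasure.scalarMeasure_univ (E : ProjectionValuedMeasure H) (v : H) :
    E.scalarMeasure v Set.univ = ENNReal.ofReal (‖v‖ ^ 2) := by
  rw [E.scalarMeasure_apply v MeasurableSet.univ, E.univ]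
  congr 1
  rw [one_apply_eq_self, inner_self_eq_norm_sq_to_K]
  norm_cast

instance (E : ProjectionValuedMeasure H) (v : H) : IsFiniteMeasure (E.scalarMeasure v) :=
  ⟨by rw [E.scalarMeasure_univ]; exact ENNReal.ofReal_lt_top⟩

theorem ProjectionValuedMeasure.scalarMeasure_compl (E : ProjectionValuedMeasure H) (v : H)
    {A : Set ℝ} (hA : MeasurableSet A) (h1 : E.proj A = 1) : E.scalarMeasure v Aᶜ = 0 := by
  have : E.proj Aᶜ = 0 := by
    rw [← mul_one (E.proj Aᶜ), ← h1, ← E.inter _ _ hA.compl hA, Set.compl_inter_self, E.empty]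
  rw [E.scalarMeasure_apply v hA.compl, this]
  simp

theorem abs_le_norm_of_mem_spectrum (T : H →L[ℂ] H) {s : ℝ} (hs : (s : ℂ) ∈ spectrum ℂ T) :
    |s| ≤ ‖T‖ := by
  -- The norm bound on the spectrum needs `‖1‖ = 1`; on the zero space the spectrum is empty.
  have hn : Nontrivial H := by
    by_contra hn
    rw [not_nontrivial_iff_subsingleton] at hn
    have : Subsingleton (H →L[ℂ] H) := ⟨fun _ _ => by ext x; exact Subsingleton.elim _ _⟩
    rw [spectrum.of_subsingleton] at hs
    exact hs
  have := spectrum.norm_le_norm_of_mem hs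
  simpa using this

theorem ProjectionValuedMeasure.IsResolutionOf.ae_abs_le {E : ProjectionValuedMeasure H}
    {T : H →L[ℂ] H} (h : E.IsResolutionOf T) (v : H) :
    ∀ᵐ s ∂(E.scalarMeasure v), |s| ≤ ‖T‖ := by
  have hA : MeasurableSet {s : ℝ | (s : ℂ) ∈ spectrum ℂ T} :=
    ((spectrum.isClosed T).preimage Complex.continuous_ofReal).measurableSet
  refine measure_mono_null ?_ (E.scalarMeasure_compl v hA h.1)
  intro s hs h'
  exact hs (abs_le_norm_of_mem_spectrum T h')

omit [CompleteSpace H] in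
theorem hilbertBasis_pow_apply {ι : Type*} (b : HilbertBasis ι ℂ H) {l : ι → ℝ} {T : H →L[ℂ] H}
    (h : ∀ i, T (b i) = (l i : ℂ) • b i) (N : ℕ) (i : ι) :
    (T ^ N) (b i) = ((l i : ℂ) ^ N) • b i := by
  induction N with
  | zero => simp
  | succ N ih => rw [pow_succ, mul_apply_eq_comp, h, map_smul, ih, smul_smul, pow_succ']

omit [CompleteSpace H] in
theorem mem_spectrum_of_apply_eq_smul {T : H →L[ℂ] H} {z : ℂ} {v : H} (h : T v = z • v)
    (hv : v ≠ 0) : z ∈ spectrum ℂ T := by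
  rw [spectrum.mem_iff]
  intro hu
  have h0 : (algebraMap ℂ (H →L[ℂ] H) z - T) v = 0 := by
    rw [sub_apply, Algebra.algebraMap_eq_smul_one, h]
    simp
  obtain ⟨u, hu⟩ := hu
  have h1 : ((↑u⁻¹ : H →L[ℂ] H) * ↑u) v = v := by rw [Units.inv_mul]; rfl
  rw [mul_apply_eq_comp, hu, h0, map_zero] at h1
  exact hv h1.symm

/-- The finite-dimensional spectral theorem, applied to the restriction of `T` to `W`. -/
theorem le_iSup_eigenspace_of_invariant {T : H →L[ℂ] H} (hT : IsSelfAdjoint T)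
    (W : Submodule ℂ H) [FiniteDimensional ℂ W] (hW : ∀ w ∈ W, T w ∈ W) :
    W ≤ ⨆ z, Module.End.eigenspace (T : H →ₗ[ℂ] H) z := by
  have hsym : (T : H →ₗ[ℂ] H).IsSymmetric := ContinuousLinearMap.isSelfAdjoint_iff_isSymmetric.1 hT
  have h := (hsym.restrict_invariant hW).orthogonalComplement_iSup_eigenspaces_eq_bot
  rw [Submodule.orthogonal_eq_bot_iff] at h
  have h' := congrArg (Submodule.map W.subtype) h
  rw [Submodule.map_iSup, Submodule.map_subtype_top] at h'
  rw [← h']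
  exact iSup_mono fun z => Module.End.eigenspace_restrict_le_eigenspace _ hW z

/-- Every `l i` is an eigenvalue, so the projections live on the spectrum. Both sides of the moment
identity expand to the sum of `|⟨b i, v⟩|² (l i)^N`. -/
theorem basisPVM_isResolutionOf {ι : Type*} (b : HilbertBasis ι ℂ H) {l : ι → ℝ} {T : H →L[ℂ] H}
    (h : ∀ i, T (b i) = (l i : ℂ) • b i) : (basisPVM b l).IsResolutionOf T := by
  have hspec : ∀ i, (l i : ℂ) ∈ spectrum ℂ T := fun i =>
    mem_spectrum_of_apply_eq_smul (h i) (b.orthonormal.ne_zero i)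
  have h1 : (basisPVM b l).proj {s : ℝ | (s : ℂ) ∈ spectrum ℂ T} = 1 :=
    hilbertBasis_clm_ext b fun i => by
      change basisProj b l _ (b i) = _
      rw [basisProj_apply, Set.indicator_of_mem
        (show i ∈ l ⁻¹' {s : ℝ | (s : ℂ) ∈ spectrum ℂ T} from hspec i)]
      rfl
  refine ⟨h1, fun N v => ?_⟩
  have hint : Integrable (fun s : ℝ => s ^ N) ((basisPVM b l).scalarMeasure v) := by
    refine Integrable.of_bound (by fun_prop) (‖T‖ ^ N) ?_
    have hA : MeasurableSet {s : ℝ | (s : ℂ) ∈ spectrum ℂ T} :=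
      ((spectrum.isClosed T).preimage Complex.continuous_ofReal).measurableSet
    refine measure_mono_null ?_ ((basisPVM b l).scalarMeasure_compl v hA h1)
    intro s hs h'
    refine hs ?_
    change ‖s ^ N‖ ≤ _
    rw [norm_pow]
    exact pow_le_pow_left₀ (norm_nonneg _) (abs_le_norm_of_mem_spectrum T h') N
  rw [basisPVM_scalarMeasure] at hint ⊢
  have hs := hasSum_integral_measure hint
  have hs' := hs.mapL Complex.ofRealCLM
  have hv := ((b.hasSum_repr v).mapL (T ^ N)).mapL (innerSL ℂ v)
  refine hv.unique ?_
  have he : ∀ i, innerSL ℂ v ((T ^ N) (b.repr v i • b i)) = Complex.ofRealCLM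
      (∫ s, s ^ N ∂(ENNReal.ofReal (‖b.repr v i‖ ^ 2) • Measure.dirac (l i))) := fun i => ?_
  · simp only [he]
    exact hs'
  rw [map_smul, hilbertBasis_pow_apply b h, map_smul, map_smul, innerSL_apply_apply,
    ← inner_conj_symm, ← b.repr_apply_apply, integral_smul_measure, integral_dirac,
    ENNReal.toReal_ofReal (by positivity)]
  simp only [smul_eq_mul, Complex.ofRealCLM_apply, Complex.ofReal_mul, Complex.ofReal_pow]
  rw [mul_left_comm, Complex.mul_conj, Complex.normSq_eq_norm_sq, mul_comm]
  push_cast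
  rfl

end Diagonal

/-! ### Measures with bounded support are determined by their moments -/

theorem integrable_pow_of_ae_abs_le {μ : Measure ℝ} [IsFiniteMeasure μ] {M : ℝ}
    (h : ∀ᵐ s ∂μ, |s| ≤ M) (N : ℕ) : Integrable (fun s : ℝ => s ^ N) μ := by
  refine Integrable.of_bound (by fun_prop) (M ^ N) ?_
  filter_upwards [h] with s hs
  rw [norm_pow]
  exact pow_le_pow_left₀ (norm_nonneg _) hs N

theorem integrable_polynomial_of_ae_abs_le {μ : Measure ℝ} [IsFiniteMeasure μ] {M : ℝ}
    (h : ∀ᵐ s ∂μ, |s| ≤ M) (p : Polynomial ℝ) : Integrable (fun s : ℝ => p.eval s) μ := by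
  simp only [Polynomial.eval_eq_sum_range]
  exact integrable_finsetSum _ fun i _ => (integrable_pow_of_ae_abs_le h i).const_mul _

/-- Equal moments give equal integrals of polynomials. By Weierstrass on `[-M, M]`, where both
measures live, the integrals of bounded continuous functions agree too. -/
theorem measure_ext_of_moments {μ ν : Measure ℝ} [IsFiniteMeasure μ] [IsFiniteMeasure ν] {M : ℝ}
    (hμ : ∀ᵐ s ∂μ, |s| ≤ M) (hν : ∀ᵐ s ∂ν, |s| ≤ M)
    (h : ∀ N : ℕ, ∫ s, s ^ N ∂μ = ∫ s, s ^ N ∂ν) : μ = ν := by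
  have hp : ∀ p : Polynomial ℝ, ∫ s, p.eval s ∂μ = ∫ s, p.eval s ∂ν := by
    intro p
    simp only [Polynomial.eval_eq_sum_range]
    rw [integral_finsetSum _ fun i _ => (integrable_pow_of_ae_abs_le hμ i).const_mul _,
      integral_finsetSum _ fun i _ => (integrable_pow_of_ae_abs_le hν i).const_mul _]
    simp only [integral_const_mul, h]
  refine ext_of_forall_integral_eq_of_IsFiniteMeasure (μ := μ) (ν := ν) fun f => ?_
  have key : ∀ (κ : Measure ℝ) [IsFiniteMeasure κ], (∀ᵐ s ∂κ, |s| ≤ M) → ∀ (p : Polynomial ℝ)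
      (ε : ℝ), (∀ s ∈ Set.Icc (-M) M, |p.eval s - f s| < ε) →
      |∫ s, p.eval s ∂κ - ∫ s, f s ∂κ| ≤ ε * κ.real Set.univ := by
    intro κ _ hκ p ε hpe
    rw [← integral_sub (integrable_polynomial_of_ae_abs_le hκ p) (f.integrable κ)]
    rw [← Real.norm_eq_abs]
    refine norm_integral_le_of_norm_le_const ?_
    filter_upwards [hκ] with s hs
    exact (hpe s (abs_le.1 hs)).le
  have hbound : ∀ ε > 0, |∫ s, f s ∂μ - ∫ s, f s ∂ν| ≤
      ε * (μ.real Set.univ + ν.real Set.univ) := by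
    intro ε hε
    obtain ⟨p, hpe⟩ := exists_polynomial_near_of_continuousOn (-M) M f f.continuous.continuousOn
      ε hε
    have h1 := key μ hμ p ε hpe
    have h2 := key ν hν p ε hpe
    rw [hp p] at h1
    rw [abs_le] at *
    constructor <;> linarith [h1.1, h1.2, h2.1, h2.2]
  by_contra hne
  have hpos : 0 < |∫ s, f s ∂μ - ∫ s, f s ∂ν| := abs_pos.2 (sub_ne_zero.2 hne)
  set C := μ.real Set.univ + ν.real Set.univ with hC
  have hC0 : 0 ≤ C := by positivity
  -- This `ε` makes `ε * C` strictly smaller than the supposed gap; the `+ 1` covers `C = 0`.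
  have := hbound (|∫ s, f s ∂μ - ∫ s, f s ∂ν| / (2 * (C + 1))) (by positivity)
  have h3 : |∫ s, f s ∂μ - ∫ s, f s ∂ν| / (2 * (C + 1)) * C <
      |∫ s, f s ∂μ - ∫ s, f s ∂ν| := by
    rw [div_mul_eq_mul_div, div_lt_iff₀ (by positivity)]
    nlinarith
  linarith

/-! ### Coordinates on weighted `ℓ²`-spaces -/

section Weighted

variable {X : Type*} [MeasurableSpace X] [DiscreteMeasurableSpace X] {m : X → ℝ}

/-- Every point has positive mass, so classes modulo null sets are honest functions and pointwise
values make sense. -/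
theorem ae_weightMeasure (hm : ∀ x, 0 < m x) {p : X → Prop} (h : ∀ᵐ x ∂(weightMeasure m), p x)
    (x : X) : p x := by
  by_contra hx
  have h0 : weightMeasure m {x} = 0 := measure_mono_null (by rintro _ rfl; exact hx) h
  rw [weightMeasure_singleton] at h0
  exact (ENNReal.ofReal_pos.2 (hm x)).ne' h0

theorem unitVec_apply [DecidableEq X] (hm : ∀ x, 0 < m x) (x y : X) :
    unitVec m x y = if y = x then (((√(m x))⁻¹ : ℝ) : ℂ) else 0 := by
  have h := ae_weightMeasure hm (indicatorConstLp_coeFn (p := 2)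
    (hs := MeasurableSet.of_discrete (s := {x}))
    (hμs := by rw [weightMeasure_singleton]; exact ENNReal.ofReal_ne_top)
    (c := (((√(m x))⁻¹ : ℝ) : ℂ)) (μ := weightMeasure m)) y
  rw [unitVec, h]
  by_cases hy : y = x
  · subst hy; simp
  · simp [hy]

theorem inner_unitVec (hm : ∀ x, 0 < m x) (x : X) (f : EllTwo m) :
    ⟪unitVec m x, f⟫_ℂ = (√(m x) : ℂ) * f x := by
  rw [unitVec, L2.inner_indicatorConstLp_eq_setIntegral_inner, integral_singleton,
    measureReal_def, weightMeasure_singleton, ENNReal.toReal_ofReal (hm x).le]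
  have h : √(m x) ≠ 0 := (Real.sqrt_pos.2 (hm x)).ne'
  rw [RCLike.inner_apply, Complex.conj_ofReal, Complex.real_smul, mul_comm (f x), ← mul_assoc,
    ← Complex.ofReal_mul]
  congr 2
  rw [← div_eq_mul_inv, Real.div_sqrt]

theorem orthonormal_unitVec (hm : ∀ x, 0 < m x) : Orthonormal ℂ (unitVec m) := by
  classical
  rw [orthonormal_iff_ite]
  intro x y
  rw [inner_unitVec hm, unitVec_apply hm]
  by_cases h : x = y
  · subst h
    have h : √(m x) ≠ 0 := (Real.sqrt_pos.2 (hm x)).ne'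
    simp [h]
  · simp [h]

/-- The orthonormal basis of normalized point masses. -/
noncomputable def unitBasis (hm : ∀ x, 0 < m x) : HilbertBasis X ℂ (EllTwo m) :=
  HilbertBasis.mkOfOrthogonalEqBot (orthonormal_unitVec hm) (by
    rw [eq_bot_iff]
    intro f hf
    rw [Submodule.mem_orthogonal] at hf
    rw [Submodule.mem_bot, Lp.eq_zero_iff_ae_eq_zero]
    refine Filter.Eventually.of_forall fun x => ?_
    have h := hf _ (Submodule.subset_span ⟨x, rfl⟩)
    rw [inner_unitVec hm] at h
    have h' : (√(m x) : ℂ) ≠ 0 := by exact_mod_cast (Real.sqrt_pos.2 (hm x)).ne'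
    simpa [h'] using h)

theorem unitBasis_apply (hm : ∀ x, 0 < m x) (x : X) : unitBasis hm x = unitVec m x := by
  simp [unitBasis]

theorem unitBasis_repr_apply (hm : ∀ x, 0 < m x) (f : EllTwo m) (x : X) :
    (unitBasis hm).repr f x = (√(m x) : ℂ) * f x := by
  rw [HilbertBasis.repr_apply_apply, unitBasis_apply, inner_unitVec hm]

theorem eq_unitBasis_repr (hm : ∀ x, 0 < m x) (f : EllTwo m) (x : X) :
    f x = (√(m x) : ℂ)⁻¹ * (unitBasis hm).repr f x := by
  have h' : (√(m x) : ℂ) ≠ 0 := by exact_mod_cast (Real.sqrt_pos.2 (hm x)).ne'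
  rw [unitBasis_repr_apply, inv_mul_cancel_left₀ h']

/-- The operator `c • A` on the unweighted space, transported to `ℓ²(X,m)`. -/
noncomputable def transport (hm : ∀ x, 0 < m x) (c : ℝ)
    (A : lp (fun _ : X => ℂ) 2 →L[ℂ] lp (fun _ : X => ℂ) 2) : EllTwo m →L[ℂ] EllTwo m :=
  (unitBasis hm).repr.toContinuousLinearEquiv.symm.conjContinuousAlgEquiv ((c : ℂ) • A)

theorem transport_apply (hm : ∀ x, 0 < m x) (c : ℝ)
    (A : lp (fun _ : X => ℂ) 2 →L[ℂ] lp (fun _ : X => ℂ) 2) (f : EllTwo m) :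
    transport hm c A f = (unitBasis hm).repr.symm ((c : ℂ) • A ((unitBasis hm).repr f)) := rfl

theorem spectrum_transport (hm : ∀ x, 0 < m x) (c : ℝ)
    (A : lp (fun _ : X => ℂ) 2 →L[ℂ] lp (fun _ : X => ℂ) 2) :
    spectrum ℂ (transport hm c A) = spectrum ℂ ((c : ℂ) • A) :=
  AlgEquiv.spectrum_eq _ _

/-- The unitary sends the normalized point mass to the unweighted point mass. The weight therefore
drops out of the moments, and only the factor `c ^ N` remains. -/
theorem inner_unitVec_transport_pow [DecidableEq X] (hm : ∀ x, 0 < m x) (c : ℝ)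
    (A : lp (fun _ : X => ℂ) 2 →L[ℂ] lp (fun _ : X => ℂ) 2) (N : ℕ) (x : X) :
    ⟪unitVec m x, (transport hm c A ^ N) (unitVec m x)⟫_ℂ =
      (c : ℂ) ^ N * (A ^ N) (lp.single 2 x 1) x := by
  have h : transport hm c A ^ N = transport hm (c ^ N) (A ^ N) := by
    rw [transport, ← map_pow, smul_pow, transport, Complex.ofReal_pow]
  rw [h, inner_unitVec hm, ← unitBasis_repr_apply hm, transport_apply,
    LinearIsometryEquiv.apply_symm_apply, ← unitBasis_apply hm, HilbertBasis.repr_self,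
    lp.coeFn_smul, Pi.smul_apply, smul_eq_mul, Complex.ofReal_pow]

theorem exists_isResolutionOf_transport (hm : ∀ x, 0 < m x) (c : ℝ)
    {A : lp (fun _ : X => ℂ) 2 →L[ℂ] lp (fun _ : X => ℂ) 2} (hA : IsSelfAdjoint A)
    (hd : (⨆ z, Module.End.eigenspace (A : lp (fun _ : X => ℂ) 2 →ₗ[ℂ] _) z)ᗮ = ⊥) :
    ∃ E : ProjectionValuedMeasure (EllTwo m), E.IsResolutionOf (transport hm c A) := by
  obtain ⟨ι, b, l, hb⟩ := exists_hilbertBasis_eigenvectors hA hd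
  let b' : HilbertBasis ι ℂ (EllTwo m) := HilbertBasis.ofRepr ((unitBasis hm).repr.trans b.repr)
  have hb' : ∀ i, b' i = (unitBasis hm).repr.symm (b i) := by
    classical
    intro i
    rw [← b'.repr_symm_single, ← b.repr_symm_single]
    rfl
  refine ⟨basisPVM b' (fun i => c * l i), basisPVM_isResolutionOf b' fun i => ?_⟩
  rw [hb', transport_apply, LinearIsometryEquiv.apply_symm_apply, hb, smul_smul, map_smul,
    Complex.ofReal_mul]

/-- A Plancherel measure exists and is unique if the moments do not depend on the base point. -/
theorem existsUnique_isPlancherelMeasure [Nonempty X] (T : EllTwo m →L[ℂ] EllTwo m)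
    (hE : ∃ E : ProjectionValuedMeasure (EllTwo m), E.IsResolutionOf T)
    (hT : ∀ (N : ℕ) (x y : X), ⟪unitVec m x, (T ^ N) (unitVec m x)⟫_ℂ =
      ⟪unitVec m y, (T ^ N) (unitVec m y)⟫_ℂ) : ∃! μ, IsPlancherelMeasure m T μ := by
  -- Comparing two resolutions at two points at once yields both independence of the base point and
  -- uniqueness.
  have key : ∀ E E' : ProjectionValuedMeasure (EllTwo m), E.IsResolutionOf T →
      E'.IsResolutionOf T → ∀ x y, E.scalarMeasure (unitVec m x) =
        E'.scalarMeasure (unitVec m y) := by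
    intro E E' h h' x y
    refine measure_ext_of_moments (h.ae_abs_le _) (h'.ae_abs_le _) fun N => ?_
    have := hT N x y
    rw [h.2, h'.2] at this
    exact_mod_cast this
  obtain ⟨E, hE⟩ := hE
  obtain ⟨x⟩ := ‹Nonempty X›
  refine ⟨E.scalarMeasure (unitVec m x), ⟨E, hE, fun y => key E E hE hE y x⟩, ?_⟩
  rintro μ ⟨E', hE', h⟩
  rw [← h x]
  exact key E' E hE' hE x x

/-- Plancherel measures of two proportional transported operators are dilates of each other. -/
theorem isPlancherelMeasure_map [DecidableEq X] [Nonempty X] {m' : X → ℝ} (hm : ∀ x, 0 < m x)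
    (hm' : ∀ x, 0 < m' x) {c c' t : ℝ} (hc : c' = t * c)
    (A : lp (fun _ : X => ℂ) 2 →L[ℂ] lp (fun _ : X => ℂ) 2)
    (h' : ∃ μ, IsPlancherelMeasure m' (transport hm' c' A) μ) {μ : Measure ℝ}
    (h : IsPlancherelMeasure m (transport hm c A) μ) :
    IsPlancherelMeasure m' (transport hm' c' A) (μ.map fun s => t * s) := by
  obtain ⟨ν, hν⟩ := h'
  -- A Plancherel measure `ν` of the second operator is already known, so it is enough to match its
  -- moments with those of the dilated measure.
  suffices μ.map (fun s => t * s) = ν by rwa [this]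
  obtain ⟨E, hE, hμ⟩ := h
  obtain ⟨E', hE', hν⟩ := hν
  obtain ⟨x⟩ := ‹Nonempty X›
  rw [← hμ x, ← hν x]
  have hmeas : Measurable fun s : ℝ => t * s := by fun_prop
  refine measure_ext_of_moments
    (M := max (|t| * ‖transport hm c A‖) ‖transport hm' c' A‖) ?_ ?_ fun N => ?_
  · rw [ae_map_iff hmeas.aemeasurable (measurableSet_le (by fun_prop) (by fun_prop))]
    filter_upwards [hE.ae_abs_le (unitVec m x)] with s hs
    rw [abs_mul]
    exact le_max_of_le_left (mul_le_mul_of_nonneg_left hs (abs_nonneg t))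
  · filter_upwards [hE'.ae_abs_le (unitVec m' x)] with s hs
    exact le_max_of_le_right hs
  · rw [integral_map hmeas.aemeasurable (by fun_prop)]
    simp only [mul_pow]
    rw [integral_const_mul]
    have h1 := hE.2 N (unitVec m x)
    have h2 := hE'.2 N (unitVec m' x)
    rw [inner_unitVec_transport_pow] at h1 h2
    rw [← Complex.ofReal_inj, ← h2, Complex.ofReal_mul, ← h1, hc]
    push_cast
    ring

end Weighted

/-! ### Summation over the edges of a biregular oriented graph -/

section EdgeSum

variable {X S T : Type*} [Fintype S] [Fintype T]

/-- Cauchy–Schwarz over the `|S|` terms costs a factor `|S|`. As `e` is a bijection, each vertex is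
the second component of at most `|T|` of the pairs counted, which costs a factor `|T|`. -/
theorem sum_norm_sq_edge_le (e : S × X ≃ T × X) (f : lp (fun _ : X => ℂ) 2) (F : Finset X) :
    ∑ x ∈ F, ‖∑ s, f (e (s, x)).2‖ ^ (2 : ℝ≥0∞).toReal ≤
      (√(Fintype.card S * Fintype.card T) * ‖f‖) ^ (2 : ℝ≥0∞).toReal := by
  classical
  have hf : ∀ F : Finset X, ∑ x ∈ F, ‖f x‖ ^ 2 ≤ ‖f‖ ^ 2 := by
    intro F
    simpa using lp.sum_rpow_le_norm_rpow (p := 2) (by simp) f F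
  simp only [ENNReal.toReal_ofNat, Real.rpow_two]
  rw [mul_pow, Real.sq_sqrt (by positivity)]
  calc ∑ x ∈ F, ‖∑ s, f (e (s, x)).2‖ ^ 2
      ≤ ∑ x ∈ F, Fintype.card S * ∑ s, ‖f (e (s, x)).2‖ ^ 2 := by
        refine Finset.sum_le_sum fun x _ => ?_
        refine (pow_le_pow_left₀ (norm_nonneg _) (norm_sum_le _ _) 2).trans ?_
        exact sq_sum_le_card_mul_sum_sq
    _ = Fintype.card S * ∑ p ∈ (Finset.univ ×ˢ F).map e.toEmbedding, ‖f p.2‖ ^ 2 := by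
        rw [← Finset.mul_sum, Finset.sum_map, Finset.sum_product_right]
        rfl
    _ ≤ Fintype.card S * ∑ p ∈ (Finset.univ : Finset T) ×ˢ
          (((Finset.univ ×ˢ F).map e.toEmbedding).image Prod.snd), ‖f p.2‖ ^ 2 := by
        gcongr
        intro p hp
        exact Finset.mem_product.2 ⟨Finset.mem_univ _, Finset.mem_image_of_mem _ hp⟩
    _ ≤ Fintype.card S * (Fintype.card T * ‖f‖ ^ 2) := by
        gcongr
        rw [Finset.sum_product]
        refine (Finset.sum_le_sum fun t _ => hf _).trans ?_
        simp
    _ = _ := by ring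

/-- The operator `f ↦ ∑ₛ f ((e (s, x)).2)` on `ℓ²(X)`. -/
noncomputable def edgeSum (e : S × X ≃ T × X) :
    lp (fun _ : X => ℂ) 2 →L[ℂ] lp (fun _ : X => ℂ) 2 :=
  LinearMap.mkContinuous
    { toFun := fun f => ⟨fun x => ∑ s, f (e (s, x)).2, memℓp_gen' (sum_norm_sq_edge_le e f)⟩
      map_add' := fun f g => by
        ext x
        simp [Finset.sum_add_distrib]
        rfl
      map_smul' := fun c f => by
        ext x
        simp [Finset.mul_sum] }
    (√(Fintype.card S * Fintype.card T))
    fun f => lp.norm_le_of_forall_sum_le (by simp) (by positivity) (sum_norm_sq_edge_le e f)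

theorem edgeSum_apply (e : S × X ≃ T × X) (f : lp (fun _ : X => ℂ) 2) (x : X) :
    edgeSum e f x = ∑ s, f (e (s, x)).2 := rfl

theorem norm_edgeSum_le (e : S × X ≃ T × X) :
    ‖edgeSum e‖ ≤ √(Fintype.card S * Fintype.card T) :=
  LinearMap.mkContinuous_norm_le _ (by positivity) _

theorem edgeSum_single [DecidableEq X] (e : S × X ≃ T × X) (y : X) :
    edgeSum e (lp.single 2 y 1) = ∑ t, lp.single 2 (e.symm (t, y)).2 1 := by
  classical
  ext x
  rw [edgeSum_apply, lp.coeFn_sum, Finset.sum_apply]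
  simp only [lp.single_apply, Pi.single_apply]
  have h1 : ∀ s, (if (e (s, x)).2 = y then (1 : ℂ) else 0) =
      ∑ t, if e (s, x) = (t, y) then 1 else 0 := by
    intro s
    simp only [Prod.ext_iff, ite_and]
    rw [Finset.sum_ite_eq]
    simp
  have h2 : ∀ t, (if x = (e.symm (t, y)).2 then (1 : ℂ) else 0) =
      ∑ s, if e (s, x) = (t, y) then 1 else 0 := by
    intro t
    simp only [← Equiv.eq_symm_apply, Prod.ext_iff, ite_and]
    rw [Finset.sum_ite_eq']
    simp
  simp only [h1, h2]
  exact Finset.sum_comm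

/-- Obtained by testing against point masses: the adjoint runs through the same edges from their
other ends. -/
theorem adjoint_edgeSum_apply (e : S × X ≃ T × X) (f : lp (fun _ : X => ℂ) 2) (y : X) :
    ContinuousLinearMap.adjoint (edgeSum e) f y = ∑ t, f (e.symm (t, y)).2 := by
  classical
  have h := ContinuousLinearMap.adjoint_inner_right (edgeSum e) (lp.single 2 y 1) f
  rw [edgeSum_single, sum_inner, lp.inner_single_left] at h
  simp only [lp.inner_single_left] at h
  simpa using h

/-- The adjacency operator `f ↦ ∑ₛ f ((e (s, x)).2) + ∑ₜ f ((e⁻¹ (t, x)).2)` on `ℓ²(X)`. -/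
noncomputable def adjacencyOp (e : S × X ≃ T × X) :
    lp (fun _ : X => ℂ) 2 →L[ℂ] lp (fun _ : X => ℂ) 2 :=
  edgeSum e + ContinuousLinearMap.adjoint (edgeSum e)

theorem adjacencyOp_apply (e : S × X ≃ T × X) (f : lp (fun _ : X => ℂ) 2) (x : X) :
    adjacencyOp e f x = ∑ s, f (e (s, x)).2 + ∑ t, f (e.symm (t, x)).2 := by
  rw [← adjoint_edgeSum_apply e f x, ← edgeSum_apply]
  rfl

theorem isSelfAdjoint_adjacencyOp (e : S × X ≃ T × X) : IsSelfAdjoint (adjacencyOp e) := by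
  rw [adjacencyOp, ← ContinuousLinearMap.star_eq_adjoint]
  exact IsSelfAdjoint.add_star_self _

theorem norm_adjacencyOp_le (e : S × X ≃ T × X) :
    ‖adjacencyOp e‖ ≤ 2 * √(Fintype.card S * Fintype.card T) := by
  refine (norm_add_le _ _).trans ?_
  rw [LinearIsometryEquiv.norm_map]
  linarith [norm_edgeSum_le e]

/-- Diagonal matrix elements of powers of the adjacency operator are invariant under
automorphisms. -/
theorem adjacencyOp_pow_single_apply [DecidableEq X] (e : S × X ≃ T × X) {g : X → X}
    (hg : Function.Injective g)
    (hS : ∀ x, ∃ π : S ≃ S, ∀ s, (e (π s, g x)).2 = g (e (s, x)).2)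
    (hT : ∀ x, ∃ π : T ≃ T, ∀ t, (e.symm (π t, g x)).2 = g (e.symm (t, x)).2) (N : ℕ) (x y : X) :
    (adjacencyOp e ^ N) (lp.single 2 (g x) 1) (g y) = (adjacencyOp e ^ N) (lp.single 2 x 1) y := by
  induction N generalizing y with
  | zero => simp [lp.single_apply, Pi.single_apply, hg.eq_iff]
  | succ N ih =>
    rw [pow_succ', mul_apply_eq_comp, mul_apply_eq_comp, adjacencyOp_apply, adjacencyOp_apply]
    obtain ⟨π, hπ⟩ := hS y
    obtain ⟨π', hπ'⟩ := hT y
    rw [← Equiv.sum_comp π, ← Equiv.sum_comp π']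
    simp only [hπ, hπ', ih]

/-- The transported adjacency operator has the expected kernel. -/
theorem isTransitionOperator_transport [MeasurableSpace X] [DiscreteMeasurableSpace X]
    [DecidableEq X] (e : S × X ≃ T × X) {m : X → ℝ} (hm : ∀ x, 0 < m x) {a b c : ℝ}
    {p : X → X → ℝ}
    (hp : ∀ x y, p x y = (∑ s, if y = (e (s, x)).2 then a else 0) +
      ∑ t, if y = (e.symm (t, x)).2 then b else 0)
    (ha : ∀ x s, c * √(m (e (s, x)).2) = a * √(m x))
    (hb : ∀ x t, c * √(m (e.symm (t, x)).2) = b * √(m x)) :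
    IsTransitionOperator m p (transport hm c (adjacencyOp e)) := by
  intro f x
  have h : HasSum (fun y => (p x y : ℂ) * f y)
      (∑ s, (a : ℂ) * f (e (s, x)).2 + ∑ t, (b : ℂ) * f (e.symm (t, x)).2) := by
    have h1 : (fun y => (p x y : ℂ) * f y) = fun y =>
        (∑ s, if y = (e (s, x)).2 then (a : ℂ) * f (e (s, x)).2 else 0) +
          ∑ t, if y = (e.symm (t, x)).2 then (b : ℂ) * f (e.symm (t, x)).2 else 0 := by
      ext y
      rw [hp]
      push_cast
      rw [add_mul, Finset.sum_mul, Finset.sum_mul]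
      congr 1 <;>
      · refine Finset.sum_congr rfl fun s _ => ?_
        split_ifs with h
        · rw [← h]
        · simp
    rw [h1]
    exact (hasSum_sum fun s _ => hasSum_ite_eq _ _).add (hasSum_sum fun t _ => hasSum_ite_eq _ _)
  refine ⟨h.summable, ?_⟩
  rw [h.tsum_eq, eq_unitBasis_repr hm, transport_apply, LinearIsometryEquiv.apply_symm_apply,
    lp.coeFn_smul, Pi.smul_apply, adjacencyOp_apply, smul_eq_mul]
  have hx : (√(m x) : ℂ) ≠ 0 := by exact_mod_cast (Real.sqrt_pos.2 (hm x)).ne'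
  -- After multiplication by `√(m x)` the two sides agree edge by edge, by `ha` and `hb`.
  rw [inv_mul_eq_iff_eq_mul₀ hx, mul_add, mul_add, Finset.mul_sum, Finset.mul_sum, Finset.mul_sum,
    Finset.mul_sum]
  congr 1
  · refine Finset.sum_congr rfl fun s _ => ?_
    have := congrArg (fun z : ℝ => (z : ℂ)) (ha x s)
    push_cast at this
    rw [unitBasis_repr_apply, ← mul_assoc, this]
    ring
  · refine Finset.sum_congr rfl fun s _ => ?_
    have := congrArg (fun z : ℝ => (z : ℂ)) (hb x s)
    push_cast at this
    rw [unitBasis_repr_apply, ← mul_assoc, this]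
    ring

end EdgeSum

/-! ### Successors and automorphisms -/

namespace Tree

variable {q : ℕ}

/-- The successor of `x` joined to `x` by an edge with label `s`. -/
noncomputable def succ (s : ZMod q) (x : Tree q) : Tree q :=
  ⟨(x.labels.mapDomain (fun i => i + 1)) + Finsupp.single 0 s, x.hor + 1⟩

@[simp]
theorem succ_hor (s : ZMod q) (x : Tree q) : (succ s x).hor = x.hor + 1 := rfl

@[simp]
theorem pred_hor (x : Tree q) : x.pred.hor = x.hor - 1 := rfl

@[simp]
theorem pred_labels (x : Tree q) (i : ℕ) : x.pred.labels i = x.labels (i + 1) := by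
  simp [pred]

@[simp]
theorem succ_labels_zero (s : ZMod q) (x : Tree q) : (succ s x).labels 0 = s := by
  simp only [succ, Finsupp.add_apply, Finsupp.single_eq_same]
  rw [Finsupp.mapDomain_of_notMem_range _ _ (by simp), zero_add]

@[simp]
theorem succ_labels_succ (s : ZMod q) (x : Tree q) (i : ℕ) :
    (succ s x).labels (i + 1) = x.labels i := by
  simp only [succ, Finsupp.add_apply]
  rw [Finsupp.mapDomain_apply (add_left_injective 1)]
  simp

@[simp]
theorem pred_succ (s : ZMod q) (x : Tree q) : (succ s x).pred = x := by
  ext <;> simp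

@[simp]
theorem succ_pred (x : Tree q) : succ (x.labels 0) x.pred = x := by
  ext i
  · cases i <;> simp
  · simp

theorem eq_succ_iff {s : ZMod q} {x y : Tree q} :
    y = succ s x ↔ y.pred = x ∧ s = y.labels 0 := by
  constructor
  · rintro rfl; simp
  · rintro ⟨rfl, rfl⟩; simp

/-- The automorphism of the tree fixing the end which moves horocycles by `k` and adds `c h` to
the labels of the edges below horocycle `h`. -/
noncomputable def auto (k : ℤ) (c : ℤ →₀ ZMod q) (x : Tree q) : Tree q where
  labels := x.labels + c.comapDomain (fun i : ℕ => x.hor - i)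
    (sub_right_injective.comp Nat.cast_injective).injOn
  hor := x.hor + k

@[simp]
theorem auto_hor (k : ℤ) (c : ℤ →₀ ZMod q) (x : Tree q) : (auto k c x).hor = x.hor + k := rfl

@[simp]
theorem auto_labels (k : ℤ) (c : ℤ →₀ ZMod q) (x : Tree q) (i : ℕ) :
    (auto k c x).labels i = x.labels i + c (x.hor - i) := by
  rw [auto, Finsupp.add_apply, Finsupp.comapDomain_apply]

theorem auto_pred (k : ℤ) (c : ℤ →₀ ZMod q) (x : Tree q) : auto k c x.pred = (auto k c x).pred := by
  ext i
  · simp only [auto_labels, pred_labels, pred_hor]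
    congr 2; push_cast; ring
  · simp only [auto_hor, pred_hor]; ring

theorem auto_succ (k : ℤ) (c : ℤ →₀ ZMod q) (s : ZMod q) (x : Tree q) :
    auto k c (succ s x) = succ (s + c (x.hor + 1)) (auto k c x) := by
  rw [eq_succ_iff, ← auto_pred, pred_succ]
  simp

theorem auto_injective (k : ℤ) (c : ℤ →₀ ZMod q) : Function.Injective (auto k c) := by
  intro x y h
  have h1 : x.hor = y.hor := by simpa using congrArg hor h
  ext i
  · have h2 := DFunLike.congr_fun (congrArg labels h) i
    simpa [h1] using h2
  · exact h1

/-- The edges of the ray from `x` lie at distinct horocycles `x.hor - i`, so `c` can correct each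
label independently. -/
theorem exists_auto_eq (x y : Tree q) : ∃ c : ℤ →₀ ZMod q, auto (y.hor - x.hor) c x = y := by
  refine ⟨(y.labels - x.labels).mapDomain (fun i : ℕ => x.hor - i), ?_⟩
  have hinj : Function.Injective fun i : ℕ => x.hor - i := fun i j h => by simpa using h
  ext i
  · rw [auto_labels, Finsupp.mapDomain_apply hinj]
    simp
  · simp

end Tree

namespace DL

variable {q r : ℕ}

theorem hor_add_hor (x : DL q r) : x.fst.hor + x.snd.hor = 0 := x.2

@[ext]
theorem ext {x y : DL q r} (h1 : x.fst = y.fst) (h2 : x.snd = y.snd) : x = y :=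
  Subtype.ext (Prod.ext h1 h2)

/-- The vertex with the given components. -/
def mk (x : Tree q) (y : Tree r) (h : x.hor + y.hor = 0) : DL q r := ⟨(x, y), h⟩

@[simp]
theorem mk_fst (x : Tree q) (y : Tree r) (h : x.hor + y.hor = 0) : (mk x y h).fst = x := rfl

@[simp]
theorem mk_snd (x : Tree q) (y : Tree r) (h : x.hor + y.hor = 0) : (mk x y h).snd = y := rfl

/-- The neighbour of `x` one step up in the first tree along the edge labelled `s`. -/
noncomputable def up (s : ZMod q) (x : DL q r) : DL q r :=
  mk (x.fst.succ s) x.snd.pred (by have := x.hor_add_hor; simp; omega)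

/-- The neighbour of `x` one step up in the second tree along the edge labelled `t`. -/
noncomputable def down (t : ZMod r) (x : DL q r) : DL q r :=
  mk x.fst.pred (x.snd.succ t) (by have := x.hor_add_hor; simp; omega)

/-- The edges of `DL(q,r)`, coded by their lower and their upper end points. -/
noncomputable def edgeEquiv (q r : ℕ) : ZMod q × DL q r ≃ ZMod r × DL q r where
  toFun p := (p.2.snd.labels 0, up p.1 p.2)
  invFun p := (p.2.fst.labels 0, down p.1 p.2)
  left_inv := by
    rintro ⟨s, x⟩
    refine Prod.ext ?_ ?_
    · simp [up]
    · ext1 <;> simp [up, down]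
  right_inv := by
    rintro ⟨s, x⟩
    refine Prod.ext ?_ ?_
    · simp [down]
    · ext1 <;> simp [up, down]

@[simp]
theorem edgeEquiv_snd (s : ZMod q) (x : DL q r) : (edgeEquiv q r (s, x)).2 = up s x := rfl

@[simp]
theorem edgeEquiv_symm_snd (t : ZMod r) (x : DL q r) :
    ((edgeEquiv q r).symm (t, x)).2 = down t x := rfl

theorem eq_up_iff {s : ZMod q} {x y : DL q r} :
    y = up s x ↔ (y.fst.pred = x.fst ∧ y.snd = x.snd.pred) ∧ s = y.fst.labels 0 := by
  rw [DL.ext_iff]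
  simp only [up, mk_fst, mk_snd, Tree.eq_succ_iff]
  tauto

theorem eq_down_iff {t : ZMod r} {x y : DL q r} :
    y = down t x ↔ (y.fst = x.fst.pred ∧ y.snd.pred = x.snd) ∧ t = y.snd.labels 0 := by
  rw [DL.ext_iff]
  simp only [down, mk_fst, mk_snd, Tree.eq_succ_iff]
  tauto

theorem up_injective (x : DL q r) : Function.Injective fun s => up s x := by
  intro s t h
  have := congrArg (fun y : DL q r => y.fst.labels 0) h
  simpa [up] using this

theorem down_injective (x : DL q r) : Function.Injective fun t => down t x := by
  intro s t h
  have := congrArg (fun y : DL q r => y.snd.labels 0) h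
  simpa [down] using this

theorem up_ne_down (s : ZMod q) (t : ZMod r) (x : DL q r) : up s x ≠ down t x := by
  intro h
  have := congrArg (fun y : DL q r => y.fst.hor) h
  simp only [up, down, mk_fst, Tree.succ_hor, Tree.pred_hor] at this
  omega

theorem graph_adj_iff {x y : DL q r} :
    (graph q r).Adj x y ↔ (∃ s, y = up s x) ∨ ∃ t, y = down t x := by
  simp only [eq_up_iff, eq_down_iff, exists_and_left, exists_eq, and_true]
  change ((_ ∨ _) ∧ (_ ∨ _)) ↔ _
  have hx := x.hor_add_hor
  have hy := y.hor_add_hor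
  constructor
  · rintro ⟨h1 | h1, h2 | h2⟩
    · exfalso
      have h1' := congrArg Tree.hor h1
      have h2' := congrArg Tree.hor h2
      simp only [Tree.pred_hor] at h1' h2'
      omega
    · exact Or.inr ⟨h1.symm, h2⟩
    · exact Or.inl ⟨h1, h2.symm⟩
    · exfalso
      have h1' := congrArg Tree.hor h1
      have h2' := congrArg Tree.hor h2
      simp only [Tree.pred_hor] at h1' h2'
      omega
  · rintro (⟨h1, h2⟩ | ⟨h1, h2⟩)
    · exact ⟨Or.inr h1, Or.inl h2.symm⟩
    · exact ⟨Or.inl h1.symm, Or.inr h2⟩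

theorem ncard_neighborSet [NeZero q] [NeZero r] (x : DL q r) :
    ((graph q r).neighborSet x).ncard = q + r := by
  have h : (graph q r).neighborSet x = Set.range (fun s => up s x) ∪ Set.range fun t => down t x := by
    ext y
    rw [SimpleGraph.mem_neighborSet, graph_adj_iff]
    simp only [Set.mem_union, Set.mem_range, eq_comm]
  rw [h, Set.ncard_union_eq, ← Set.image_univ, ← Set.image_univ,
    Set.ncard_image_of_injective _ (up_injective x),
    Set.ncard_image_of_injective _ (down_injective x), Set.ncard_univ, Set.ncard_univ,
    Nat.card_zmod, Nat.card_zmod]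
  rw [Set.disjoint_left]
  rintro _ ⟨s, rfl⟩ ⟨t, h⟩
  exact up_ne_down s t x h.symm

theorem sum_ite_eq_up [NeZero q] (x y : DL q r) [DecidableEq (DL q r)]
    [Decidable (y.fst.pred = x.fst ∧ y.snd = x.snd.pred)] (a : ℝ) :
    (∑ s, if y = up s x then a else 0) =
      if y.fst.pred = x.fst ∧ y.snd = x.snd.pred then a else 0 := by
  classical
  simp only [eq_up_iff, ite_and (_ ∧ _)]
  split_ifs
  · simp
  · simp

theorem sum_ite_eq_down [NeZero r] (x y : DL q r) [DecidableEq (DL q r)]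
    [Decidable (y.fst = x.fst.pred ∧ y.snd.pred = x.snd)] (a : ℝ) :
    (∑ t, if y = down t x then a else 0) =
      if y.fst = x.fst.pred ∧ y.snd.pred = x.snd then a else 0 := by
  classical
  simp only [eq_down_iff, ite_and (_ ∧ _)]
  split_ifs
  · simp
  · simp

theorem driftKernel_eq [NeZero q] [NeZero r] [DecidableEq (DL q r)] (α : ℝ) (x y : DL q r) :
    driftKernel q r α x y = (∑ s, if y = up s x then α / q else 0) +
      ∑ t, if y = down t x then (1 - α) / r else 0 := by
  classical
  rw [sum_ite_eq_up, sum_ite_eq_down, driftKernel]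
  by_cases h : y.fst.pred = x.fst ∧ y.snd = x.snd.pred
  · rw [if_pos h, if_pos h, if_neg, add_zero]
    rintro ⟨h1, _⟩
    have h2 := congrArg Tree.hor h.1
    have h1 := congrArg Tree.hor h1
    simp only [Tree.pred_hor] at h1 h2
    omega
  · rw [if_neg h, if_neg h, zero_add]

theorem srwKernel_eq [NeZero q] [NeZero r] [DecidableEq (DL q r)] (x y : DL q r) :
    srwKernel (graph q r) x y = (∑ s, if y = up s x then 1 / ((q : ℝ) + r) else 0) +
      ∑ t, if y = down t x then 1 / ((q : ℝ) + r) else 0 := by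
  classical
  rw [srwKernel, ncard_neighborSet, graph_adj_iff, Nat.cast_add]
  by_cases h : ∃ s, y = up s x
  · obtain ⟨s, rfl⟩ := h
    rw [if_pos (Or.inl ⟨s, rfl⟩)]
    simp only [(up_injective x).eq_iff, up_ne_down]
    simp
  · by_cases h' : ∃ t, y = down t x
    · obtain ⟨t, rfl⟩ := h'
      rw [if_pos (Or.inr ⟨t, rfl⟩)]
      simp only [(down_injective x).eq_iff, (up_ne_down _ _ _).symm]
      simp
    · rw [if_neg (by tauto)]
      push Not at h h'
      simp [h, h']

/-- The adjacency operator of `DL(q,r)`. -/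
noncomputable abbrev adjOp (q r : ℕ) [NeZero q] [NeZero r] :
    lp (fun _ : DL q r => ℂ) 2 →L[ℂ] lp (fun _ : DL q r => ℂ) 2 :=
  adjacencyOp (edgeEquiv q r)

/-- `DL` is vertex-transitive: a tree automorphism shifting horocycles by `k`, paired with one
shifting by `-k`, preserves `DL`, and such pairs reach every vertex. -/
theorem adjOp_pow_single_apply_self [NeZero q] [NeZero r] [DecidableEq (DL q r)] (N : ℕ)
    (x y : DL q r) :
    (adjOp q r ^ N) (lp.single 2 x 1) x = (adjOp q r ^ N) (lp.single 2 y 1) y := by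
  obtain ⟨c, hc⟩ := Tree.exists_auto_eq x.fst y.fst
  obtain ⟨d, hd⟩ := Tree.exists_auto_eq x.snd y.snd
  set k := y.fst.hor - x.fst.hor with hk
  have hk' : y.snd.hor - x.snd.hor = -k := by
    have := x.hor_add_hor
    have := y.hor_add_hor
    omega
  rw [hk'] at hd
  let g : DL q r → DL q r := fun z => mk (z.fst.auto k c) (z.snd.auto (-k) d) (by
    have := z.hor_add_hor
    simp; omega)
  have hg : g x = y := by ext1 <;> simp [g, hc, hd]
  rw [← hg]
  refine (adjacencyOp_pow_single_apply (edgeEquiv q r) (g := g) ?_ ?_ ?_ N x x).symm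
  · intro z w h
    ext1
    · exact Tree.auto_injective k c (congrArg fst h)
    · exact Tree.auto_injective (-k) d (congrArg snd h)
  · intro z
    -- The automorphism permutes the upper neighbours by translating their labels.
    refine ⟨Equiv.addRight (c (z.fst.hor + 1)), fun s => ?_⟩
    ext1 <;> simp [g, up, Tree.auto_succ, Tree.auto_pred]
  · intro z
    refine ⟨Equiv.addRight (d (z.snd.hor + 1)), fun s => ?_⟩
    ext1 <;> simp [g, down, Tree.auto_succ, Tree.auto_pred]

theorem norm_adjOp_le [NeZero q] [NeZero r] : ‖adjOp q r‖ ≤ 2 * √((q : ℝ) * r) := by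
  simpa [ZMod.card] using norm_adjacencyOp_le (edgeEquiv q r)

instance : Nonempty (DL q r) := ⟨mk ⟨0, 0⟩ ⟨0, 0⟩ rfl⟩

end DL

/-! ### Finitely supported eigenfunctions -/

namespace Tree

variable {q : ℕ}

/-- The function on generation `k` below `a` that equals `c s` below the successor of `a` with
label `s`; it is zero for `k = 0`. -/
noncomputable def haar (a : Tree q) (c : ZMod q → ℂ) : ℕ → Tree q → ℂ
  | 0, _ => 0
  | k + 1, x => open Classical in if pred^[k + 1] x = a then c (x.labels k) else 0

theorem iterate_pred_eq_of_haar_ne_zero {a : Tree q} {c : ZMod q → ℂ} {k : ℕ} {x : Tree q}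
    (h : haar a c k x ≠ 0) : pred^[k] x = a := by
  cases k with
  | zero => exact absurd rfl h
  | succ k =>
    by_contra hx
    exact h (if_neg hx)

theorem haar_of_eq {a : Tree q} (c : ZMod q → ℂ) {k : ℕ} {x : Tree q} (h : pred^[k + 1] x = a) :
    haar a c (k + 1) x = c (x.labels k) := if_pos h

theorem haar_of_ne {a : Tree q} (c : ZMod q → ℂ) {k : ℕ} {x : Tree q} (h : pred^[k + 1] x ≠ a) :
    haar a c (k + 1) x = 0 := if_neg h

theorem haar_pred (a : Tree q) (c : ZMod q → ℂ) (k : ℕ) (x : Tree q) :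
    haar a c (k + 1) x.pred = haar a c (k + 2) x := by
  by_cases h : pred^[k + 1] x.pred = a
  · rw [haar_of_eq c h, haar_of_eq c (by exact h), pred_labels]
  · rw [haar_of_ne c h, haar_of_ne c (by exact h)]

/-- Below generation one the value depends on a label inherited by all `q` successors. At `k = 0`
the sum over the successors of `a` vanishes because `c` has zero sum, which is why `haar` is set to
zero there. -/
theorem sum_haar_succ [NeZero q] (a : Tree q) {c : ZMod q → ℂ} (hc : ∑ s, c s = 0) (k : ℕ)
    (x : Tree q) : ∑ s, haar a c (k + 1) (succ s x) = q * haar a c k x := by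
  have hpred : ∀ (k : ℕ) (s : ZMod q), pred^[k + 1] (succ s x) = pred^[k] x := fun k s => by
    rw [Function.iterate_succ_apply, pred_succ]
  cases k with
  | zero =>
    have h0 : (q : ℂ) * haar a c 0 x = 0 := mul_zero _
    rw [h0]
    by_cases h : x = a
    · simpa only [haar_of_eq c ((hpred 0 _).trans h), succ_labels_zero] using hc
    · exact Finset.sum_eq_zero fun s _ => haar_of_ne c (by rw [hpred]; exact h)
  | succ k =>
    by_cases h : pred^[k + 1] x = a
    · simp only [haar_of_eq c ((hpred (k + 1) _).trans h), succ_labels_succ, haar_of_eq c h]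
      simp [ZMod.card]
    · rw [haar_of_ne c h, mul_zero]
      exact Finset.sum_eq_zero fun s _ => haar_of_ne c (by rw [hpred]; exact h)

theorem exists_finset_iterate_pred_eq [NeZero q] (a : Tree q) (k : ℕ) :
    ∃ F : Finset (Tree q), (∀ x, pred^[k] x = a → x ∈ F) ∧ F.card ≤ q ^ k := by
  classical
  induction k with
  | zero => exact ⟨{a}, by simp, by simp⟩
  | succ k ih =>
    obtain ⟨F, hF, hc⟩ := ih
    refine ⟨((Finset.univ : Finset (ZMod q)) ×ˢ F).image fun p => succ p.1 p.2, fun x hx => ?_, ?_⟩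
    · exact Finset.mem_image.2 ⟨(x.labels 0, x.pred), by simp [hF _ hx], succ_pred x⟩
    · refine Finset.card_image_le.trans ?_
      rw [Finset.card_product, Finset.card_univ, ZMod.card, pow_succ']
      gcongr

/-- The average of the point masses over the `k`-th generation below the `k`-th ancestor of `x`. -/
noncomputable def avg (x : Tree q) (k : ℕ) (y : Tree q) : ℂ :=
  open Classical in if pred^[k] y = pred^[k] x then ((q : ℂ) ^ k)⁻¹ else 0

theorem avg_zero [DecidableEq (Tree q)] (x y : Tree q) : avg x 0 y = if y = x then 1 else 0 := by
  simp [avg]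

/-- Below the `(k+1)`-st ancestor, the difference depends only on the branch: `q^(-k) (1 - 1/q)` on
the branch of `x`, `-q^(-k-1)` on the others. This is a Haar function whose coefficients sum to
zero. -/
theorem avg_sub_avg (x : Tree q) (k : ℕ) (y : Tree q) :
    avg x k y - avg x (k + 1) y = haar (pred^[k + 1] x)
      (fun s => ((q : ℂ) ^ k)⁻¹ * ((if s = x.labels k then 1 else 0) - (q : ℂ)⁻¹)) (k + 1) y := by
  classical
  have h : pred^[k] y = pred^[k] x ↔
      pred^[k + 1] y = pred^[k + 1] x ∧ y.labels k = x.labels k := by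
    simp only [Function.iterate_succ_apply']
    have h0 := fun z : Tree q => iterate_pred_labels z k 0
    simp only [zero_add] at h0
    rw [← h0 y, ← h0 x]
    constructor
    · intro h; simp [h]
    · rintro ⟨h1, h2⟩
      rw [← succ_pred (pred^[k] y), h1, h2, succ_pred]
  by_cases h1 : pred^[k + 1] y = pred^[k + 1] x
  · rw [haar_of_eq _ h1]
    simp only [avg, h]
    by_cases h2 : y.labels k = x.labels k
    · rw [if_pos ⟨h1, h2⟩, if_pos h1, if_pos h2, pow_succ, mul_inv]
      ring
    · rw [if_neg fun h => h2 h.2, if_pos h1, if_neg h2, pow_succ, mul_inv]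
      ring
  · rw [haar_of_ne _ h1, avg, avg, if_neg h1, if_neg fun h' => h1 (h.1 h').1, sub_zero]

theorem sum_avg_coeff [NeZero q] (k : ℕ) (t : ZMod q) :
    ∑ s, ((q : ℂ) ^ k)⁻¹ * ((if s = t then 1 else 0) - (q : ℂ)⁻¹) = 0 := by
  have hq : (q : ℂ) ≠ 0 := Nat.cast_ne_zero.2 (NeZero.ne q)
  rw [← Finset.mul_sum, Finset.sum_sub_distrib]
  simp [ZMod.card, hq]

end Tree

namespace DL

open DiestelLeader.Tree

variable {q r : ℕ} [NeZero q] [NeZero r]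

theorem exists_finset_iterate_pred_eq (a : Tree q) (b : Tree r) (k l : ℕ) :
    ∃ F : Finset (DL q r), (∀ x : DL q r, pred^[k] x.fst = a → pred^[l] x.snd = b → x ∈ F) ∧
      F.card ≤ q ^ k * r ^ l := by
  classical
  obtain ⟨F, hF, hFc⟩ := Tree.exists_finset_iterate_pred_eq a k
  obtain ⟨G, hG, hGc⟩ := Tree.exists_finset_iterate_pred_eq b l
  have hinj : Function.Injective fun x : DL q r => (x.fst, x.snd) := fun x y h => by
    rw [Prod.ext_iff] at h
    exact DL.ext h.1 h.2
  refine ⟨(F ×ˢ G).preimage _ hinj.injOn, fun x h1 h2 => ?_, ?_⟩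
  · exact Finset.mem_preimage.2 (Finset.mem_product.2 ⟨hF _ h1, hG _ h2⟩)
  · rw [Finset.card_preimage]
    refine (Finset.card_filter_le _ _).trans ?_
    rw [Finset.card_product]
    exact Nat.mul_le_mul hFc hGc

/-- The product of two functions supported on generations of the two trees, as an element of
`ℓ²`. -/
noncomputable def prodVec {f : Tree q → ℂ} {g : Tree r → ℂ} {a : Tree q} {b : Tree r} {k l : ℕ}
    (hf : ∀ x, f x ≠ 0 → pred^[k] x = a) (hg : ∀ x, g x ≠ 0 → pred^[l] x = b) :
    lp (fun _ : DL q r => ℂ) 2 :=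
  ⟨fun x => f x.fst * g x.snd, by
    refine (memℓp_zero ?_).of_exponent_ge zero_le
    obtain ⟨F, hF, -⟩ := exists_finset_iterate_pred_eq a b k l
    refine F.finite_toSet.subset fun x hx => ?_
    exact hF x (hf _ (left_ne_zero_of_mul hx)) (hg _ (right_ne_zero_of_mul hx))⟩

/-- The product of two Haar functions. -/
noncomputable def haarVec (a : Tree q) (b : Tree r) (c : ZMod q → ℂ) (d : ZMod r → ℂ) (k l : ℕ) :
    lp (fun _ : DL q r => ℂ) 2 :=
  prodVec (f := haar a c k) (g := haar b d l) (fun _ => iterate_pred_eq_of_haar_ne_zero)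
    (fun _ => iterate_pred_eq_of_haar_ne_zero)

theorem haarVec_apply (a : Tree q) (b : Tree r) (c : ZMod q → ℂ) (d : ZMod r → ℂ) (k l : ℕ)
    (x : DL q r) : haarVec a b c d k l x = haar a c k x.fst * haar b d l x.snd := rfl

theorem haarVec_zero_left (a : Tree q) (b : Tree r) (c : ZMod q → ℂ) (d : ZMod r → ℂ) (l : ℕ) :
    haarVec a b c d 0 l = 0 := by
  ext x
  rw [haarVec_apply]
  exact zero_mul _

theorem haarVec_zero_right (a : Tree q) (b : Tree r) (c : ZMod q → ℂ) (d : ZMod r → ℂ) (k : ℕ) :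
    haarVec a b c d k 0 = 0 := by
  ext x
  rw [haarVec_apply]
  exact mul_zero _

/-- A step up in one tree averages its Haar factor one generation back, while the predecessor step
pushes the other factor one generation on. The total `k + l` is conserved. -/
theorem adjOp_haarVec (a : Tree q) (b : Tree r) {c : ZMod q → ℂ} {d : ZMod r → ℂ}
    (hc : ∑ s, c s = 0) (hd : ∑ t, d t = 0) (k l : ℕ) :
    adjOp q r (haarVec a b c d (k + 1) (l + 1)) =
      (q : ℂ) • haarVec a b c d k (l + 2) + (r : ℂ) • haarVec a b c d (k + 2) l := by
  ext x
  rw [adjacencyOp_apply, lp.coeFn_add, Pi.add_apply, lp.coeFn_smul, lp.coeFn_smul, Pi.smul_apply,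
    Pi.smul_apply]
  simp only [edgeEquiv_snd, edgeEquiv_symm_snd, haarVec_apply, up, down, mk_fst, mk_snd, haar_pred,
    smul_eq_mul]
  rw [← Finset.sum_mul, ← Finset.mul_sum, sum_haar_succ a hc, sum_haar_succ b hd]
  ring

/-- The products with a given sum of levels span a finite-dimensional invariant space; the chain
closes up because the products with a level `0` vanish. -/
theorem haarVec_mem_iSup_eigenspace (a : Tree q) (b : Tree r) {c : ZMod q → ℂ} {d : ZMod r → ℂ}
    (hc : ∑ s, c s = 0) (hd : ∑ t, d t = 0) (k l : ℕ) :
    haarVec a b c d k l ∈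
      ⨆ z, Module.End.eigenspace (adjOp q r : lp (fun _ : DL q r => ℂ) 2 →ₗ[ℂ] _) z := by
  set W := Submodule.span ℂ
    ((fun p : ℕ × ℕ => haarVec a b c d p.1 p.2) '' {p | p.1 + p.2 = k + l})
    with hWdef
  have hmem : ∀ i j, i + j = k + l → haarVec a b c d i j ∈ W := fun i j h =>
    Submodule.subset_span ⟨(i, j), h, rfl⟩
  have : FiniteDimensional ℂ W :=
    FiniteDimensional.span_of_finite ℂ (Set.Finite.image _
      ((Finset.HasAntidiagonal.antidiagonal (k + l)).finite_toSet.subset fun p hp =>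
        Finset.mem_coe.2 (Finset.HasAntidiagonal.mem_antidiagonal.2 hp)))
  refine le_iSup_eigenspace_of_invariant (isSelfAdjoint_adjacencyOp _) W ?_ (hmem k l rfl)
  intro w hw
  induction hw using Submodule.span_induction with
  | mem w hw =>
    obtain ⟨⟨i, j⟩, hij, rfl⟩ := hw
    replace hij : i + j = k + l := hij
    rcases i with _ | i
    · simp only [haarVec_zero_left, map_zero]; exact W.zero_mem
    rcases j with _ | j
    · simp only [haarVec_zero_right, map_zero]; exact W.zero_mem
    simp only [adjOp_haarVec a b hc hd]
    exact W.add_mem (W.smul_mem _ (hmem _ _ (by omega))) (W.smul_mem _ (hmem _ _ (by omega)))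
  | zero => rw [map_zero]; exact W.zero_mem
  | add u v _ _ hu hv => rw [map_add]; exact W.add_mem hu hv
  | smul z u _ hu => rw [map_smul]; exact W.smul_mem _ hu

/-- The product of two averages. -/
noncomputable def avgVec (x : DL q r) (k l : ℕ) : lp (fun _ : DL q r => ℂ) 2 :=
  prodVec (f := avg x.fst k) (g := avg x.snd l)
    (a := pred^[k] x.fst) (b := pred^[l] x.snd) (k := k) (l := l)
    (fun _ h => by by_contra h'; exact h (if_neg h'))
    (fun _ h => by by_contra h'; exact h (if_neg h'))

theorem avgVec_apply (x : DL q r) (k l : ℕ) (y : DL q r) :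
    avgVec x k l y = avg x.fst k y.fst * avg x.snd l y.snd := rfl

theorem avgVec_zero_zero [DecidableEq (DL q r)] (x : DL q r) :
    avgVec x 0 0 = lp.single 2 x 1 := by
  classical
  ext y
  rw [avgVec_apply, avg_zero, avg_zero, lp.single_apply, Pi.single_apply]
  simp only [DL.ext_iff, ite_and]
  split_ifs <;> simp

/-- The mixed difference factors into one difference of averages in each tree, hence is a product of
two zero-sum Haar functions. -/
theorem avgVec_mixed_difference (x : DL q r) (k l : ℕ) :
    avgVec x k l - avgVec x (k + 1) l - (avgVec x k (l + 1) - avgVec x (k + 1) (l + 1)) ∈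
      ⨆ z, Module.End.eigenspace (adjOp q r : lp (fun _ : DL q r => ℂ) 2 →ₗ[ℂ] _) z := by
  convert haarVec_mem_iSup_eigenspace (pred^[k + 1] x.fst) (pred^[l + 1] x.snd)
    (sum_avg_coeff k (x.fst.labels k)) (sum_avg_coeff l (x.snd.labels l)) (k + 1) (l + 1) using 1
  ext y
  rw [haarVec_apply, ← avg_sub_avg, ← avg_sub_avg]
  simp only [lp.coeFn_sub, Pi.sub_apply, avgVec_apply]
  ring

theorem norm_avgVec_le (x : DL q r) (k l : ℕ) :
    ‖avgVec x k l‖ ≤ √(((q : ℝ) ^ k * (r : ℝ) ^ l)⁻¹) := by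
  classical
  refine lp.norm_le_of_forall_sum_le (by simp) (by positivity) fun S => ?_
  simp only [ENNReal.toReal_ofNat, Real.rpow_two]
  rw [Real.sq_sqrt (by positivity)]
  obtain ⟨F, hF, hFc⟩ := exists_finset_iterate_pred_eq (pred^[k] x.fst) (pred^[l] x.snd) k l
  set Q : ℝ := (q : ℝ) ^ k * (r : ℝ) ^ l with hQ
  have hq : (0 : ℝ) < q := Nat.cast_pos.2 (NeZero.pos q)
  have hr : (0 : ℝ) < r := Nat.cast_pos.2 (NeZero.pos r)
  have hQ0 : 0 < Q := by positivity
  have hval : ∀ y, ‖avgVec x k l y‖ ^ 2 ≤ if y ∈ F then Q⁻¹ ^ 2 else 0 := by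
    intro y
    rw [avgVec_apply, avg, avg]
    by_cases h1 : pred^[k] y.fst = pred^[k] x.fst
    · by_cases h2 : pred^[l] y.snd = pred^[l] x.snd
      · rw [if_pos h1, if_pos h2, if_pos (hF y h1 h2)]
        simp [hQ, mul_comm]
      · rw [if_neg h2]; simp; split_ifs <;> positivity
    · rw [if_neg h1]; simp; split_ifs <;> positivity
  calc ∑ y ∈ S, ‖avgVec x k l y‖ ^ 2 ≤ ∑ y ∈ S, if y ∈ F then Q⁻¹ ^ 2 else 0 :=
        Finset.sum_le_sum fun y _ => hval y
    _ ≤ ∑ y ∈ F, Q⁻¹ ^ 2 := by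
        rw [← Finset.sum_filter]
        exact Finset.sum_le_sum_of_subset_of_nonneg
          (fun y hy => (Finset.mem_filter.1 hy).2) fun _ _ _ => by positivity
    _ = F.card * Q⁻¹ ^ 2 := by simp
    _ ≤ Q * Q⁻¹ ^ 2 := by
        gcongr
        rw [hQ]
        exact_mod_cast hFc
    _ = Q⁻¹ := by field_simp

/-- The eigenfunctions of the adjacency operator are complete. -/
theorem iSup_eigenspace_adjOp_orthogonal (hq : 2 ≤ q) (hr : 2 ≤ r) :
    (⨆ z, Module.End.eigenspace (adjOp q r : lp (fun _ : DL q r => ℂ) 2 →ₗ[ℂ] _) z)ᗮ = ⊥ := by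
  classical
  rw [eq_bot_iff]
  intro f hf
  rw [Submodule.mem_orthogonal] at hf
  rw [Submodule.mem_bot]
  ext x
  have hq1 : (1 : ℝ) < q := by exact_mod_cast hq
  have hr1 : (1 : ℝ) < r := by exact_mod_cast hr
  let u : ℕ → ℕ → ℂ := fun k l => ⟪avgVec x k l, f⟫_ℂ
  have hbound : ∀ k l, ‖u k l‖ ≤ √(((q : ℝ) ^ k * (r : ℝ) ^ l)⁻¹) * ‖f‖ := fun k l =>
    (norm_inner_le_norm _ _).trans
      (mul_le_mul_of_nonneg_right (norm_avgVec_le x k l) (norm_nonneg f))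
  have hlim : ∀ a : ℝ, 0 < a → ∀ b : ℝ, 1 < b → Filter.Tendsto
      (fun n : ℕ => √((a * b ^ n)⁻¹) * ‖f‖) Filter.atTop (nhds 0) := by
    intro a ha b hb
    have h := ((tendsto_pow_atTop_atTop_of_one_lt hb).const_mul_atTop ha).inv_tendsto_atTop
    simpa using (h.sqrt).mul_const ‖f‖
  have hlimk : ∀ l, Filter.Tendsto (fun k => u k l) Filter.atTop (nhds 0) := by
    intro l
    refine squeeze_zero_norm (fun k => hbound k l) ?_
    simpa only [mul_comm ((r : ℝ) ^ l)] using hlim ((r : ℝ) ^ l) (by positivity) q hq1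
  have hliml : ∀ k, Filter.Tendsto (fun l => u k l) Filter.atTop (nhds 0) := fun k =>
    squeeze_zero_norm (fun l => hbound k l) (hlim ((q : ℝ) ^ k) (by positivity) r hr1)
  -- Orthogonality to the eigenspaces kills all mixed differences of `u`. Since `u` tends to zero in
  -- each variable, it vanishes along `k = 0`, and `u 0 0` is `f x`.
  have hrec : ∀ k l, u (k + 1) l - u (k + 1) (l + 1) = u k l - u k (l + 1) := by
    intro k l
    have h := hf _ (avgVec_mixed_difference x k l)
    simp only [inner_sub_left] at h
    linear_combination -h
  have hconst : ∀ l k, u k l - u k (l + 1) = u 0 l - u 0 (l + 1) := by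
    intro l k
    induction k with
    | zero => rfl
    | succ k ih => rw [hrec, ih]
  have hstep : ∀ l, u 0 l = u 0 (l + 1) := by
    intro l
    have h1 := (hlimk l).sub (hlimk (l + 1))
    simp only [hconst l, sub_zero] at h1
    exact sub_eq_zero.1 (tendsto_nhds_unique tendsto_const_nhds h1)
  have hall : ∀ l, u 0 l = u 0 0 := by
    intro l
    induction l with
    | zero => rfl
    | succ l ih => rw [← hstep, ih]
  have h0 := hliml 0
  simp only [hall] at h0
  have h00 : u 0 0 = 0 := tendsto_nhds_unique tendsto_const_nhds h0
  simp only [u, avgVec_zero_zero, lp.inner_single_left] at h00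
  simpa using h00

/-! ### The spectrum of the adjacency operator -/

/-- Summation by parts: `g` solves the transposed tridiagonal recurrence, and the boundary terms
vanish at `0` and `N + 1`. -/
theorem sum_range_mul_recurrence {V : Type*} [AddCommGroup V] [Module ℂ V] {N : ℕ} {g : ℕ → ℂ}
    {h : ℕ → V} {a b z : ℂ} (hg : ∀ k, z * g (k + 1) = a * g (k + 2) + b * g k) (hg0 : g 0 = 0)
    (hgN : g (N + 1) = 0) (hh0 : h 0 = 0) (hhN : h (N + 1) = 0) :
    ∑ k ∈ Finset.range N, g (k + 1) • (a • h k + b • h (k + 2)) =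
      z • ∑ k ∈ Finset.range N, g (k + 1) • h (k + 1) := by
  have h1 : ∑ k ∈ Finset.range N, (a * g (k + 2)) • h (k + 1) =
      ∑ k ∈ Finset.range N, (a * g (k + 1)) • h k := by
    have e1 := Finset.sum_range_succ (fun k => (a * g (k + 1)) • h k) N
    rw [Finset.sum_range_succ'] at e1
    simpa [hh0, hgN] using e1
  have h2 : ∑ k ∈ Finset.range N, (b * g k) • h (k + 1) =
      ∑ k ∈ Finset.range N, (b * g (k + 1)) • h (k + 2) := by
    have e1 := Finset.sum_range_succ (fun k => (b * g k) • h (k + 1)) N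
    rw [Finset.sum_range_succ'] at e1
    simpa [hhN, hg0] using e1.symm
  rw [Finset.smul_sum]
  simp only [smul_smul, hg, add_smul, smul_add]
  rw [Finset.sum_add_distrib, Finset.sum_add_distrib, h1, h2]
  simp only [mul_comm]

theorem cos_mem_spectrum_adjOp (hq : 2 ≤ q) (hr : 2 ≤ r) {j n : ℕ} (hj : 0 < j) (hjn : j < n) :
    ((2 * √((q : ℝ) * r) * Real.cos (j / n * Real.pi) : ℝ) : ℂ) ∈ spectrum ℂ (adjOp q r) := by
  classical
  obtain ⟨N, rfl⟩ : ∃ N, n = N + 1 := ⟨n - 1, by omega⟩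
  have hq0 : (0 : ℝ) < q := by positivity
  have hr0 : (0 : ℝ) < r := by positivity
  have : Fact (1 < q) := ⟨hq⟩
  have : Fact (1 < r) := ⟨hr⟩
  set θ : ℝ := j / (N + 1 : ℕ) * Real.pi with hθ
  -- With `q w = √(qr)` and `q w² = r`, the substitution `g k = w^k s k` reduces the recurrence to
  -- `2 cos θ s (k+1) = s (k+2) + s k`, solved by `sin (k θ)`.
  set w : ℝ := √((r : ℝ) / q) with hw
  have hw0 : 0 < w := by positivity
  have hz : √((q : ℝ) * r) = q * w := by
    rw [hw, ← Real.sqrt_sq hq0.le, ← Real.sqrt_mul (by positivity), Real.sqrt_sq hq0.le]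
    congr 1
    field_simp
  have hw2 : q * w ^ 2 = r := by
    rw [hw, Real.sq_sqrt (by positivity)]
    field_simp
  let g : ℕ → ℝ := fun k => w ^ k * Real.sin (k * θ)
  have hg : ∀ k, 2 * √((q : ℝ) * r) * Real.cos θ * g (k + 1) = q * g (k + 2) + r * g k := by
    intro k
    have e1 : ((k + 2 : ℕ) : ℝ) * θ = (k + 1 : ℕ) * θ + θ := by push_cast; ring
    have e2 : (k : ℝ) * θ = (k + 1 : ℕ) * θ - θ := by push_cast; ring
    simp only [g]
    rw [e1, e2, Real.sin_add, Real.sin_sub, hz, ← hw2]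
    ring
  -- Zero-sum coefficients with `δ 0 = 1`; this value needs `0 ≠ 1` in `ZMod p`, hence degrees at
  -- least `2`.
  let δ : ∀ {p : ℕ}, ZMod p → ℂ := fun {p} s => (if s = 0 then 1 else 0) - if s = 1 then 1 else 0
  have hδq : ∑ s : ZMod q, δ s = 0 := by simp [δ]
  have hδr : ∑ s : ZMod r, δ s = 0 := by simp [δ]
  let o : DL q r := mk ⟨0, 0⟩ ⟨0, 0⟩ rfl
  let h : ℕ → lp (fun _ : DL q r => ℂ) 2 := fun k =>
    haarVec (pred^[1] o.fst) (pred^[N] o.snd) δ δ k (N + 1 - k)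
  have hA : ∀ k ∈ Finset.range N, adjOp q r (h (k + 1)) = (q : ℂ) • h k + (r : ℂ) • h (k + 2) := by
    intro k hk
    obtain ⟨l, rfl⟩ : ∃ l, N = k + l + 1 := ⟨N - k - 1, by
      have := Finset.mem_range.1 hk
      omega⟩
    simp only [h]
    rw [show k + l + 1 + 1 - (k + 1) = l + 1 by omega, show k + l + 1 + 1 - k = l + 2 by omega,
      show k + l + 1 + 1 - (k + 2) = l by omega, adjOp_haarVec _ _ hδq hδr]
  refine mem_spectrum_of_apply_eq_smul
    (v := ∑ k ∈ Finset.range N, (g (k + 1) : ℂ) • h (k + 1)) ?_ ?_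
  · rw [map_sum, ← sum_range_mul_recurrence (g := fun k => (g k : ℂ)) (h := h) (a := q) (b := r)]
    · exact Finset.sum_congr rfl fun k hk => by rw [map_smul, hA k hk]
    · intro k
      exact_mod_cast hg k
    · simp [g]
    · have : ((N + 1 : ℕ) : ℝ) * θ = j * Real.pi := by
        rw [hθ]; field_simp
      simp only [g, this, Real.sin_nat_mul_pi, mul_zero, Complex.ofReal_zero]
    · exact haarVec_zero_left _ _ _ _ _
    · simp only [h, Nat.sub_self]
      exact haarVec_zero_right _ _ _ _ _
  -- At `o` only the term with `h 1` survives, since `o.fst` is in generation one below its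
  -- predecessor; its coefficient is `w sin θ > 0`.
  · intro hv
    have hv' := congrArg (fun f : lp (fun _ : DL q r => ℂ) 2 => f o) hv
    simp only [lp.coeFn_sum, Finset.sum_apply, lp.coeFn_smul, Pi.smul_apply, lp.coeFn_zero,
      Pi.zero_apply] at hv'
    rw [Finset.sum_eq_single_of_mem 0 (Finset.mem_range.2 (by omega))] at hv'
    · have h1 : h (0 + 1) o = 1 := by
        obtain ⟨M, rfl⟩ : ∃ M, N = M + 1 := ⟨N - 1, by omega⟩
        simp only [h, haarVec_apply]
        rw [show M + 1 + 1 - (0 + 1) = M + 1 by omega]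
        simp [haar, o, δ]
      rw [h1, smul_eq_mul, mul_one, Complex.ofReal_eq_zero] at hv'
      have hθ0 : 0 < θ := by positivity
      have hθπ : θ < Real.pi := by
        rw [hθ]
        have : (j : ℝ) / (N + 1 : ℕ) < 1 := by
          rw [div_lt_one (by positivity)]
          exact_mod_cast hjn
        nlinarith [Real.pi_pos]
      have := Real.sin_pos_of_pos_of_lt_pi hθ0 hθπ
      simp only [g, zero_add, Nat.cast_one, one_mul, pow_one] at hv'
      exact (mul_pos hw0 this).ne' hv'
    · intro k _ hk
      rw [smul_eq_mul, mul_eq_zero]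
      right
      by_contra hne
      simp only [h, haarVec_apply] at hne
      have := congrArg hor (iterate_pred_eq_of_haar_ne_zero (left_ne_zero_of_mul hne))
      rw [iterate_pred_hor, iterate_pred_hor] at this
      push_cast at this
      omega

/-- The norm bound and self-adjointness give one inclusion. Conversely, rational angles in `(0, π)`
(as multiples of `π`) give eigenvalues, and the spectrum is closed. -/
theorem spectrum_adjOp (hq : 2 ≤ q) (hr : 2 ≤ r) :
    spectrum ℂ (adjOp q r) = Complex.ofReal ''
      Set.Icc (-(2 * √((q : ℝ) * r))) (2 * √((q : ℝ) * r)) := by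
  have hpos : (0 : ℝ) < 2 * √((q : ℝ) * r) := by positivity
  ext z
  constructor
  · intro hz
    have hre := (isSelfAdjoint_adjacencyOp (edgeEquiv q r)).mem_spectrum_eq_re hz
    rw [hre] at hz
    exact ⟨z.re, abs_le.1 ((abs_le_norm_of_mem_spectrum _ hz).trans norm_adjOp_le), hre.symm⟩
  · rintro ⟨s, hs, rfl⟩
    let C : Set ℝ := {t | ((2 * √((q : ℝ) * r) * Real.cos (t * Real.pi) : ℝ) : ℂ) ∈
      spectrum ℂ (adjOp q r)}
    have hC : IsClosed C := (spectrum.isClosed _).preimage (by fun_prop)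
    have hrat : Set.Ioo (0 : ℝ) 1 ∩ Set.range ((↑) : ℚ → ℝ) ⊆ C := by
      rintro _ ⟨⟨h0, h1⟩, ⟨t, rfl⟩⟩
      have h0 : 0 < t := by exact_mod_cast h0
      have h1 : t < 1 := by exact_mod_cast h1
      have hnum : 0 < t.num := Rat.num_pos.2 h0
      obtain ⟨j, hj⟩ := Int.eq_ofNat_of_zero_le hnum.le
      have hjd : j < t.den := by
        have := Rat.num_lt_denom_iff.2 h1
        omega
      have := cos_mem_spectrum_adjOp hq hr (j := j) (n := t.den) (by omega) hjd
      have ht : (t : ℝ) = j / t.den := by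
        rw [Rat.cast_def, hj]
        simp
      simp only [C, Set.mem_ofPred_eq]
      rw [ht]
      exact this
    have hIcc : Set.Icc (0 : ℝ) 1 ⊆ C := by
      rw [← closure_Ioo (zero_ne_one' ℝ)]
      refine closure_minimal ?_ hC
      exact ((Rat.isDenseEmbedding_coe_real.dense).open_subset_closure_inter isOpen_Ioo).trans
        (closure_minimal hrat hC)
    have hs1 : -1 ≤ s / (2 * √((q : ℝ) * r)) := by
      rw [le_div_iff₀ hpos]; linarith [hs.1]
    have hs2 : s / (2 * √((q : ℝ) * r)) ≤ 1 := by
      rw [div_le_iff₀ hpos]; linarith [hs.2]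
    have hmem : Real.arccos (s / (2 * √((q : ℝ) * r))) / Real.pi ∈ C := hIcc
      ⟨div_nonneg (Real.arccos_nonneg _) Real.pi_pos.le,
        (div_le_one Real.pi_pos).2 (Real.arccos_le_pi _)⟩
    simp only [C, Set.mem_ofPred_eq] at hmem
    rwa [div_mul_cancel₀ _ Real.pi_pos.ne', Real.cos_arccos hs1 hs2,
      mul_div_cancel₀ _ hpos.ne'] at hmem

end DL

/-! ### The two random walks -/

section Walks

variable {q r : ℕ} [NeZero q] [NeZero r]

open DL
open scoped Pointwise

theorem driftWeight_pos {α : ℝ} (hα0 : 0 < α) (hα1 : α < 1) (x : DL q r) :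
    0 < driftWeight q r α x := by
  have hq : (0 : ℝ) < q := Nat.cast_pos.2 (NeZero.pos q)
  have hr : (0 : ℝ) < r := Nat.cast_pos.2 (NeZero.pos r)
  have : 0 < 1 - α := sub_pos.2 hα1
  exact zpow_pos (by positivity) _

theorem isTransitionOperator_srw :
    IsTransitionOperator (fun _ => 1) (srwKernel (DL.graph q r))
      (transport (fun _ => one_pos) (1 / ((q : ℝ) + r)) (adjOp q r)) := by
  classical
  exact isTransitionOperator_transport _ _ (a := 1 / ((q : ℝ) + r)) (b := 1 / ((q : ℝ) + r))
    srwKernel_eq (fun _ _ => rfl) (fun _ _ => rfl)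

/-- A step up in the first tree multiplies the weight by `β = αr/((1-α)q)`, and `(α/q)/√β =
((1-α)/r)√β = √(α(1-α)/(qr))`: after conjugation both directions carry the same coefficient. -/
theorem isTransitionOperator_drift {α : ℝ} (hα0 : 0 < α) (hα1 : α < 1) :
    IsTransitionOperator (driftWeight q r α) (driftKernel q r α)
      (transport (driftWeight_pos hα0 hα1) √(α * (1 - α) / (q * r)) (adjOp q r)) := by
  classical
  have hq : (0 : ℝ) < q := Nat.cast_pos.2 (NeZero.pos q)
  have hr : (0 : ℝ) < r := Nat.cast_pos.2 (NeZero.pos r)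
  have h1 : 0 < 1 - α := sub_pos.2 hα1
  have hβ : 0 < α * r / ((1 - α) * q) := by positivity
  refine isTransitionOperator_transport _ _ (a := α / q) (b := (1 - α) / r)
    (driftKernel_eq α) (fun x s => ?_) (fun x t => ?_)
  · rw [← Real.sqrt_mul (by positivity), edgeEquiv_snd, driftWeight, driftWeight, up, mk_fst,
      Tree.succ_hor, zpow_add₀ hβ.ne', zpow_one, ← Real.sqrt_sq (show 0 ≤ α / q by positivity),
      ← Real.sqrt_mul (by positivity)]
    congr 1
    field_simp
  · rw [← Real.sqrt_mul (by positivity), edgeEquiv_symm_snd, driftWeight, driftWeight, down, mk_fst,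
      Tree.pred_hor, zpow_sub₀ hβ.ne', zpow_one,
      ← Real.sqrt_sq (show 0 ≤ (1 - α) / r by positivity), ← Real.sqrt_mul (by positivity)]
    congr 1
    field_simp

theorem spectrum_transport_adjOp (hq : 2 ≤ q) (hr : 2 ≤ r) {m : DL q r → ℝ} (hm : ∀ x, 0 < m x)
    {c : ℝ} (hc : 0 < c) :
    spectrum ℂ (transport hm c (adjOp q r)) = Complex.ofReal ''
      Set.Icc (-(c * (2 * √((q : ℝ) * r)))) (c * (2 * √((q : ℝ) * r))) := by
  have hc' : (c : ℂ) ≠ 0 := by exact_mod_cast hc.ne'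
  have h := spectrum.unit_smul_eq_smul (adjOp q r) (Units.mk0 (c : ℂ) hc')
  rw [spectrum_transport]
  change spectrum ℂ ((c : ℂ) • adjOp q r) = (c : ℂ) • spectrum ℂ (adjOp q r) at h
  rw [h, spectrum_adjOp hq hr, ← mul_neg c, ← Set.image_mul_left_Icc' hc]
  rw [← Set.image_smul, Set.image_image, Set.image_image]
  simp

theorem existsUnique_isPlancherelMeasure_transport (hq : 2 ≤ q) (hr : 2 ≤ r) {m : DL q r → ℝ}
    (hm : ∀ x, 0 < m x) (c : ℝ) :
    ∃! μ, IsPlancherelMeasure m (transport hm c (adjOp q r)) μ := by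
  classical
  refine existsUnique_isPlancherelMeasure _ (exists_isResolutionOf_transport hm c
    (isSelfAdjoint_adjacencyOp _) (iSup_eigenspace_adjOp_orthogonal hq hr)) fun N x y => ?_
  rw [inner_unitVec_transport_pow, inner_unitVec_transport_pow, adjOp_pow_single_apply_self N x y]

end Walks

end DiestelLeader

open DiestelLeader in
theorem corollary7p1 (q r : ℕ) (hq : 2 ≤ q) (hr : 2 ≤ r) (α : ℝ) (hα0 : 0 < α) (hα1 : α < 1) :
    ∃ (P : EllTwo (fun _ : DL q r => (1 : ℝ)) →L[ℂ] EllTwo (fun _ : DL q r => (1 : ℝ)))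
      (Pα : EllTwo (driftWeight q r α) →L[ℂ] EllTwo (driftWeight q r α)),
      -- `P` is simple random walk on `ℓ²(DL)`, and `Pα` is the drifted walk on `ℓ²(DL, m_α)`
      IsTransitionOperator (fun _ => 1) (srwKernel (DL.graph q r)) P ∧
      IsTransitionOperator (driftWeight q r α) (driftKernel q r α) Pα ∧
      -- the spectra
      spectrum ℂ P = Complex.ofReal '' Set.Icc (-rho q r) (rho q r) ∧
      spectrum ℂ Pα =
        Complex.ofReal '' Set.Icc (-√(4 * α * (1 - α))) (√(4 * α * (1 - α))) ∧
      spectrum ℂ Pα = (fun z => (dilationFactor q r α : ℂ) * z) '' spectrum ℂ P ∧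
      -- the Plancherel measures
      (∃! μ, IsPlancherelMeasure (fun _ => 1) P μ) ∧
      (∃! μ, IsPlancherelMeasure (driftWeight q r α) Pα μ) ∧
      ∀ μ, IsPlancherelMeasure (fun _ => 1) P μ →
        IsPlancherelMeasure (driftWeight q r α) Pα
          (μ.map fun s => dilationFactor q r α * s) := by
  classical
  have : NeZero q := ⟨by omega⟩
  have : NeZero r := ⟨by omega⟩
  have hq0 : (0 : ℝ) < q := Nat.cast_pos.2 (NeZero.pos q)
  have hr0 : (0 : ℝ) < r := Nat.cast_pos.2 (NeZero.pos r)
  have h1 : 0 < 1 - α := sub_pos.2 hα1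
  have hc : 0 < 1 / ((q : ℝ) + r) := by positivity
  have hc' : 0 < √(α * (1 - α) / (q * r)) := by positivity
  have hρ : 1 / ((q : ℝ) + r) * (2 * √((q : ℝ) * r)) = rho q r := by
    rw [rho]; ring
  have hρ' : √(α * (1 - α) / (q * r)) * (2 * √((q : ℝ) * r)) = √(4 * α * (1 - α)) := by
    rw [mul_left_comm, ← Real.sqrt_mul (by positivity), div_mul_cancel₀ _ (by positivity),
      show 4 * α * (1 - α) = 2 ^ 2 * (α * (1 - α)) by ring, Real.sqrt_mul (sq_nonneg 2),
      Real.sqrt_sq zero_le_two]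
  have hρ0 : 0 < rho q r := by rw [← hρ]; positivity
  -- The dilation factor is the quotient of the two scalars in front of the common adjacency
  -- operator.
  have ht : √(α * (1 - α) / (q * r)) = dilationFactor q r α * (1 / ((q : ℝ) + r)) := by
    rw [dilationFactor, ← hρ, ← hρ']
    field_simp
  have ht0 : 0 < dilationFactor q r α := by
    rw [dilationFactor, ← hρ']; positivity
  have htρ : dilationFactor q r α * rho q r = √(4 * α * (1 - α)) :=
    div_mul_cancel₀ _ hρ0.ne'
  have hP := spectrum_transport_adjOp (q := q) (r := r) (m := fun _ => 1) hq hr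
    (fun _ => one_pos) hc
  have hPα := spectrum_transport_adjOp hq hr (driftWeight_pos (q := q) (r := r) hα0 hα1) hc'
  rw [hρ] at hP
  rw [hρ'] at hPα
  refine ⟨_, _, isTransitionOperator_srw, isTransitionOperator_drift hα0 hα1, hP, hPα, ?_,
    existsUnique_isPlancherelMeasure_transport hq hr _ _,
    existsUnique_isPlancherelMeasure_transport hq hr _ _, fun μ hμ =>
    isPlancherelMeasure_map _ _ ht _
      (existsUnique_isPlancherelMeasure_transport hq hr _ _).exists hμ⟩
  rw [hPα, hP, ← htρ, ← mul_neg (dilationFactor q r α), ← Set.image_mul_left_Icc' ht0, Set.image_image,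
    Set.image_image]
  simp
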